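/- **Setting.** Let $x$ be an affine coordinate and $\theta_1,\theta_2$ odd Grassmann coordinates. A superfunction is $f=f_0+\theta_1f_1+\theta_2f_2+\theta_1\theta_2f_{12}$ with complex-valued smooth $f_0,f_1,f_2,f_{12}$ of $x$; it is even ($\tilde f=0$) if $f_1=f_2=0$ and odd ($\tilde f=1$) if $f_0=f_{12}=0$. Put $\bar D_i=\partial_{\theta_i}-\theta_i\partial_x$ for $i=1,2$, $f'=\partial_xf$, $X_f=f\partial_x-(-1)^{\tilde f}\tfrac12(\bar D_1(f)\bar D_1+\bar D_2(f)\bar D_2)$ and $L^{w}_{X_f}=X_f+wf'$ for $w\in\mathbb C$. Let $\mathfrak{spo}(2|2)$ be the span of the fields $X_f$ with $f\in\{1,x,\theta_1,\theta_2,\theta_1\theta_2,x^2,x\theta_1,x\theta_2\}$. Let $\lambda,\mu\in\mathbb C$ and $\delta=\mu-\lambda$. On differential operators $D$ (finite sums of $a\,\partial_x^l\bar D_1^m\bar D_2^n$ with $a$ a superfunction) let $\mathcal L_{X_f}D=L^\mu_{X_f}\circ D-(-1)^{\tilde f\tilde D}D\circ L^\lambda_{X_f}$. Such an operator has order at most $k\in\frac12\mathbb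 N$ if only terms with $l+\frac m2+\frac n2\le k$ occur. Operators of order at most $k$ modulo those of order at most $k-\frac12$ form the space $\mathcal S^k$ of symbols of degree $k$, with the induced action $L_{X_f}[D]=[\mathcal L_{X_f}D]$. A symbol of degree $k$ is written as a pair $(F_1,F_2)$ of superfunctions, which stands for the class of $$Q_{\rm Aff}(F_1,F_2)=\begin{cases}F_1\partial_x^k+F_2\partial_x^{k-1}\bar D_1\bar D_2,&k\in\mathbb N,\\ F_1\partial_x^{k-\frac12}\bar D_1+F_2\partial_x^{k-\frac12}\bar D_2,&k\in\frac12+\mathbb N,\end{cases}$$ with $F_2=0$ if $k=0$. This defines a linear bijection $Q_{\rm Aff}$ from $\mathcal S=\bigoplus_{k\in\frac12\mathbb N}\mathcal S^k$ to the space of differential operators. Let $\mathcal C$ be the Casimir operator of $\mathfrak{spo}(2|2)$ on $\mathcal S$ for the action $Q_{\rm Aff}^{-1}\circ\mathcal L_X\circ Q_{\rm Aff}$ and the form $K(A,B)=2\,\mathrm{str}(AB)$, that is, $\sum_i\beta(u_i^*)\beta(u_i)$ with $\beta$ this action, $u_i$ the fields of the Hamiltonians $1,\theta_1,\theta_2,x,\theta_1\theta_2,x\theta_1,x\theta_2,x^2$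 and $u_i^*$ those of $-\frac12x^2,-x\theta_1,-x\theta_2,x,\theta_1\theta_2,\theta_1,\theta_2,-\frac12$. Put $\alpha_k=(\delta-k)^2$ for $k\in\mathbb N$ and $\alpha_k=(\delta-k)^2-\frac14$ for $k\in\frac12+\mathbb N$; $\delta$ is critical if $\alpha_k=\alpha_l$ for some $l<k$ in $\frac12\mathbb N$. An $\mathfrak{spo}(2|2)$-equivariant quantization is a linear bijection $Q$ from $\mathcal S$ to the space of differential operators such that $Q(S)$ has order at most $k$ and principal symbol $S$ for every $S\in\mathcal S^k$, and $\mathcal L_X\circ Q=Q\circ L_X$ for all $X\in\mathfrak{spo}(2|2)$. **Proposition.** Let $\delta$ be non-critical and let $k\in\mathbb N$. For every $S_k\in\mathcal S^k$ there is a unique $\hat S=S_k+S_{k-\frac12}+S_{k-1}+\dots+S_0$ with $S_j\in\mathcal S^j$ and $\mathcal C\hat S=\alpha_k\hat S$, and $Q(S_k)=Q_{\rm Aff}(\hat S)$ for every $\mathfrak{spo}(2|2)$-equivariant quantization $Q$. Its components are as follows. Put $A_i=-i$ and $B_i=-(i+2\lambda)$. For every integer $l$ with $1\le l\le k$, $$S_{k-l}=C_l\begin{pmatrix}A_kB_{k-l}\partial_x^l&0\\0&A_{k-l}B_k\partial_x^l\end{pmatrix}S_k+D_l\begin{pmatrix}A_kB_{k-l}\partial_x^l&-B_kB_{k-l}\bar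 D_1\bar D_2\partial_x^{l-1}\\A_kA_{k-l}\bar D_1\bar D_2\partial_x^{l-1}&A_{k-l}B_k\partial_x^l\end{pmatrix}S_k,$$ $$C_l=\frac{\prod_{i=1}^{l-1}A_{k-i}B_{k-i}}{\prod_{i=1}^l(\alpha_k-\alpha_{k-i})},\qquad D_l=\frac{-l\prod_{i=1}^{l-1}A_{k-i}B_{k-i}}{2(\alpha_k-\alpha_{k-\frac12})\prod_{i=1}^l(\alpha_k-\alpha_{k-i})}.$$ For every $l\in\frac12+\mathbb N$ with $l<k$, if both components of $S_k$ are homogeneous of the same parity $\tilde S_k\in\{0,1\}$, $$S_{k-l}=(-1)^{\tilde S_k}E_l\begin{pmatrix}A_k\bar D_1&B_k\bar D_2\\A_k\bar D_2&-B_k\bar D_1\end{pmatrix}\partial_x^{\lfloor l\rfloor}S_k,\qquad E_l=\frac{\prod_{i=1}^{l-\frac12}A_{k-i}B_{k-i}}{2(\alpha_k-\alpha_{k-\frac12})\prod_{i=1}^{l-\frac12}(\alpha_k-\alpha_{k-i})}.$$ In particular, with the formula for $\alpha_j$ used for $j\in\{k-\frac12,k-1\}$ also if $k=0$, $C_1=\frac1{\alpha_k-\alpha_{k-1}}$,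 $D_1=-\frac1{2(\alpha_k-\alpha_{k-\frac12})(\alpha_k-\alpha_{k-1})}$ and $E_{\frac12}=\frac1{2(\alpha_k-\alpha_{k-\frac12})}$. -/

import Mathlib

namespace SuperQuant

noncomputable section

/-- Smooth complex-valued functions of the affine coordinate `x`. -/
def Smooth : Subalgebra ℂ (ℝ → ℂ) where
  carrier := {f | ContDiff ℝ ((⊤ : ℕ∞) : WithTop ℕ∞) f}
  mul_mem' hf hg := Set.mem_ofPred.2 ((Set.mem_ofPred.1 hf).mul (Set.mem_ofPred.1 hg))
  add_mem' hf hg := Set.mem_ofPred.2 ((Set.mem_ofPred.1 hf).add (Set.mem_ofPred.1 hg))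
  algebraMap_mem' c := Set.mem_ofPred.2 (contDiff_const (c := c))

theorem Smooth.mem_iff {f : ℝ → ℂ} :
    f ∈ Smooth ↔ ContDiff ℝ ((⊤ : ℕ∞) : WithTop ℕ∞) f :=
  Set.mem_ofPred

theorem Smooth.contDiff (f : Smooth) : ContDiff ℝ ((⊤ : ℕ∞) : WithTop ℕ∞) f.1 :=
  Smooth.mem_iff.1 f.2

theorem Smooth.differentiable (f : Smooth) : Differentiable ℝ f.1 :=
  (Smooth.contDiff f).differentiable (by simp)

/-- The derivative `d/dx` on smooth functions. -/
def Smooth.D : Smooth →ₗ[ℂ] Smooth where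
  toFun f := ⟨deriv f.1, Smooth.mem_iff.2 (contDiff_infty_iff_deriv.1 (Smooth.contDiff f)).2⟩
  map_add' f g := by
    apply Subtype.ext
    funext x
    exact deriv_add (Smooth.differentiable f x) (Smooth.differentiable g x)
  map_smul' c f := by
    apply Subtype.ext
    funext x
    exact deriv_const_mul c (Smooth.differentiable f x)

/-- The coordinate function `x`. -/
def Smooth.x : Smooth :=
  ⟨fun t => (t : ℂ), Smooth.mem_iff.2 Complex.ofRealCLM.contDiff⟩

/-- Superfunctions `c0 + θ₁ c1 + θ₂ c2 + θ₁ θ₂ c12` with smooth coefficients. -/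
@[ext]
structure SF where
  c0 : Smooth
  c1 : Smooth
  c2 : Smooth
  c12 : Smooth

namespace SF

/-- A superfunction is the same as the quadruple of its components. -/
def equiv : SF ≃ Smooth × Smooth × Smooth × Smooth where
  toFun f := (f.c0, f.c1, f.c2, f.c12)
  invFun t := ⟨t.1, t.2.1, t.2.2.1, t.2.2.2⟩
  left_inv _ := rfl
  right_inv _ := rfl

instance : AddCommGroup SF := equiv.addCommGroup

instance : Module ℂ SF := equiv.module ℂ

@[simp] theorem add_c0 (f g : SF) : (f + g).c0 = f.c0 + g.c0 := rfl
@[simp] theorem add_c1 (f g : SF) : (f + g).c1 = f.c1 + g.c1 := rfl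
@[simp] theorem add_c2 (f g : SF) : (f + g).c2 = f.c2 + g.c2 := rfl
@[simp] theorem add_c12 (f g : SF) : (f + g).c12 = f.c12 + g.c12 := rfl
@[simp] theorem smul_c0 (c : ℂ) (f : SF) : (c • f).c0 = c • f.c0 := rfl
@[simp] theorem smul_c1 (c : ℂ) (f : SF) : (c • f).c1 = c • f.c1 := rfl
@[simp] theorem smul_c2 (c : ℂ) (f : SF) : (c • f).c2 = c • f.c2 := rfl
@[simp] theorem smul_c12 (c : ℂ) (f : SF) : (c • f).c12 = c • f.c12 := rfl

/-- The product of superfunctions, determined by `θ₁² = θ₂² = 0` and `θ₂ θ₁ = - θ₁ θ₂`. -/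
instance : Mul SF where
  mul a b :=
    { c0 := a.c0 * b.c0
      c1 := a.c0 * b.c1 + a.c1 * b.c0
      c2 := a.c0 * b.c2 + a.c2 * b.c0
      c12 := a.c0 * b.c12 + a.c12 * b.c0 + (a.c1 * b.c2 - a.c2 * b.c1) }

@[simp] theorem mul_c0 (a b : SF) : (a * b).c0 = a.c0 * b.c0 := rfl
@[simp] theorem mul_c1 (a b : SF) : (a * b).c1 = a.c0 * b.c1 + a.c1 * b.c0 := rfl
@[simp] theorem mul_c2 (a b : SF) : (a * b).c2 = a.c0 * b.c2 + a.c2 * b.c0 := rfl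
@[simp] theorem mul_c12 (a b : SF) : (a * b).c12 =
    a.c0 * b.c12 + a.c12 * b.c0 + (a.c1 * b.c2 - a.c2 * b.c1) := rfl

/-- `HasParity 0 f` says that `f` is even, `HasParity 1 f` that it is odd. -/
def HasParity (p : Fin 2) (f : SF) : Prop :=
  if p = 0 then f.c1 = 0 ∧ f.c2 = 0 else f.c0 = 0 ∧ f.c12 = 0

/-- The even part of a superfunction. -/
def evenPart (f : SF) : SF := ⟨f.c0, 0, 0, f.c12⟩

/-- The odd part of a superfunction. -/
def oddPart (f : SF) : SF := ⟨0, f.c1, f.c2, 0⟩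

end SF

/-- Linear operators on superfunctions. -/
abbrev Op := Module.End ℂ SF

/-- Left multiplication by a superfunction. -/
def mulLeft : SF →ₗ[ℂ] Op :=
  LinearMap.mk₂ ℂ (fun a b => a * b)
    (fun a a' b => by ext1 <;> simp <;> ring)
    (fun c a b => by ext1 <;> simp [smul_sub])
    (fun a b b' => by ext1 <;> simp <;> ring)
    (fun c a b => by ext1 <;> simp [smul_sub])

/-- The grading involution: `f ↦ (-1)^(parity of f) f`. -/
def gradInv : Op where
  toFun f := ⟨f.c0, -f.c1, -f.c2, f.c12⟩
  map_add' f g := by ext1 <;> simp [add_comm]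
  map_smul' c f := by ext1 <;> simp

/-- The even vector field `∂_x`. -/
def dx : Op where
  toFun f := ⟨Smooth.D f.c0, Smooth.D f.c1, Smooth.D f.c2, Smooth.D f.c12⟩
  map_add' f g := by ext1 <;> simp
  map_smul' c f := by ext1 <;> simp

/-- The odd vector field `∂_{θ₁}`. -/
def dθ₁ : Op where
  toFun f := ⟨f.c1, 0, f.c12, 0⟩
  map_add' f g := by ext1 <;> simp
  map_smul' c f := by ext1 <;> simp

/-- The odd vector field `∂_{θ₂}`. -/
def dθ₂ : Op where
  toFun f := ⟨f.c2, -f.c12, 0, 0⟩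
  map_add' f g := by ext1 <;> simp [add_comm]
  map_smul' c f := by ext1 <;> simp

/-- The odd coordinate `θ₁`. -/
def θ₁ : SF := ⟨0, 1, 0, 0⟩

/-- The odd coordinate `θ₂`. -/
def θ₂ : SF := ⟨0, 0, 1, 0⟩

/-- `D̄₁ = ∂_{θ₁} - θ₁ ∂_x`. -/
def Dbar₁ : Op := dθ₁ - mulLeft θ₁ * dx

/-- `D̄₂ = ∂_{θ₂} - θ₂ ∂_x`. -/
def Dbar₂ : Op := dθ₂ - mulLeft θ₂ * dx

/-- The contact vector field
`X_f = f ∂_x - (-1)^f ½ (D̄₁(f) D̄₁ + D̄₂(f) D̄₂)`, extended linearly to all `f`. -/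
def contactField (f : SF) : Op :=
  mulLeft f * dx - (1 / 2 : ℂ) •
    (mulLeft (Dbar₁ (gradInv f)) * Dbar₁ + mulLeft (Dbar₂ (gradInv f)) * Dbar₂)

/-- The Lie derivative `X_f + w f'` of densities of weight `w`. -/
def densityLie (w : ℂ) (f : SF) : Op := contactField f + w • mulLeft (dx f)

/-- The Lie derivative of an operator from `lam`-densities to `mu`-densities:
`L^mu_f ∘ D - (-1)^(f D) D ∘ L^lam_f` for homogeneous `f` and `D`, extended bilinearly.
For odd `f`, the operator `(-1)^D D` is `D` conjugated by the grading involution. -/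
def opLie (lam mu : ℂ) (f : SF) (D : Op) : Op :=
  densityLie mu f * D - D * densityLie lam f.evenPart
    - gradInv * D * gradInv * densityLie lam f.oddPart

/-- The contact Hamiltonians `1, θ₁, θ₂, x, θ₁θ₂, xθ₁, xθ₂, x²` whose contact vector fields
form a basis of `spo(2|2)`. -/
def spoGen : Fin 8 → SF :=
  ![⟨1, 0, 0, 0⟩, ⟨0, 1, 0, 0⟩, ⟨0, 0, 1, 0⟩, ⟨Smooth.x, 0, 0, 0⟩, ⟨0, 0, 0, 1⟩,
    ⟨0, Smooth.x, 0, 0⟩, ⟨0, 0, Smooth.x, 0⟩, ⟨Smooth.x ^ 2, 0, 0, 0⟩]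

/-- The space of contact Hamiltonians of `spo(2|2)`. -/
def spo : Submodule ℂ SF := Submodule.span ℂ (Set.range spoGen)

/-- The Hamiltonians `-x²/2, -xθ₁, -xθ₂, x, θ₁θ₂, θ₁, θ₂, -1/2` of the basis dual to `spoGen`
for the form `K(A, B) = 2 str(AB)`; see `spo_dual_basis`. -/
def spoDual : Fin 8 → SF :=
  ![-((1 / 2 : ℂ) • spoGen 7), -spoGen 5, -spoGen 6, spoGen 3, spoGen 4, spoGen 1, spoGen 2,
    -((1 / 2 : ℂ) • spoGen 0)]

/-- The matrices in `gl(2|2)` (two even, then two odd coordinates) that realize the fields with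
Hamiltonians `spoGen`. -/
def spoMat : Fin 8 → Matrix (Fin 4) (Fin 4) ℚ :=
  ![!![0, 0, 0, 0; -1, 0, 0, 0; 0, 0, 0, 0; 0, 0, 0, 0],
    !![0, 0, 0, 0; 0, 0, 1/2, 0; -1/2, 0, 0, 0; 0, 0, 0, 0],
    !![0, 0, 0, 0; 0, 0, 0, 1/2; 0, 0, 0, 0; -1/2, 0, 0, 0],
    !![1/2, 0, 0, 0; 0, -1/2, 0, 0; 0, 0, 0, 0; 0, 0, 0, 0],
    !![0, 0, 0, 0; 0, 0, 0, 0; 0, 0, 0, 1/2; 0, 0, -1/2, 0],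
    !![0, 0, -1/2, 0; 0, 0, 0, 0; 0, -1/2, 0, 0; 0, 0, 0, 0],
    !![0, 0, 0, -1/2; 0, 0, 0, 0; 0, 0, 0, 0; 0, -1/2, 0, 0],
    !![0, 1, 0, 0; 0, 0, 0, 0; 0, 0, 0, 0; 0, 0, 0, 0]]

/-- The matrices of the fields with Hamiltonians `spoDual`. -/
def spoMatDual : Fin 8 → Matrix (Fin 4) (Fin 4) ℚ :=
  ![-((1 / 2 : ℚ) • spoMat 7), -spoMat 5, -spoMat 6, spoMat 3, spoMat 4, spoMat 1, spoMat 2,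
    -((1 / 2 : ℚ) • spoMat 0)]

/-- The supertrace on `gl(2|2)`. -/
def str (M : Matrix (Fin 4) (Fin 4) ℚ) : ℚ := M 0 0 + M 1 1 - M 2 2 - M 3 3

set_option maxHeartbeats 2000000 in
/-- The two bases are `K`-dual: `K(u_i, u_j^*) = δ_ij`. -/
theorem spo_dual_basis (i j : Fin 8) :
    2 * str (spoMat i * spoMatDual j) = if i = j then 1 else 0 := by
  revert i j
  decide +kernel

/-- The Casimir operator `∑ β(u_i^*) β(u_i)` of `spo(2|2)` for the action `opLie lam mu` on
operators. -/
def casimir (lam mu : ℂ) (D : Op) : Op :=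
  ∑ i : Fin 8, opLie lam mu (spoDual i) (opLie lam mu (spoGen i) D)

/-! Degrees and orders are half-integers; the degree `k` is encoded by the natural
number `n = 2k`. -/

/-- Differential operators of order at most `n / 2`. -/
def diffOps (n : ℕ) : Submodule ℂ Op :=
  Submodule.span ℂ {D | ∃ (a : SF) (l m p : ℕ), 2 * l + m + p ≤ n ∧
    D = mulLeft a * dx ^ l * Dbar₁ ^ m * Dbar₂ ^ p}

/-- Differential operators of order less than `n / 2`; this is `0` for `n = 0`. -/
def lowerDiffOps (n : ℕ) : Submodule ℂ Op :=
  Submodule.span ℂ {D | ∃ (a : SF) (l m p : ℕ), 2 * l + m + p < n ∧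
    D = mulLeft a * dx ^ l * Dbar₁ ^ m * Dbar₂ ^ p}

/-- All differential operators. -/
def allDiffOps : Submodule ℂ Op := ⨆ n, diffOps n

/-- Symbols of degree `n / 2`, as pairs of densities. In degree zero there is only the
monomial `∂_x^0`, so the second component vanishes. -/
def symbolPairs (n : ℕ) : Submodule ℂ (SF × SF) where
  carrier := {F | n = 0 → F.2 = 0}
  add_mem' := fun ha hb h => by simp [ha h, hb h]
  zero_mem' := fun _ => rfl
  smul_mem' := fun c F hF h => by simp [hF h]

/-- The graded space of symbols. -/
abbrev Symbols := DirectSum ℕ fun n => symbolPairs n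

/-- The affine quantization of symbols of degree `n / 2`:
`F₁ ∂_x^k + F₂ ∂_x^(k-1) D̄₁ D̄₂` for `n = 2k` (with `F₂ = 0` if `k = 0`), and
`F₁ ∂_x^j D̄₁ + F₂ ∂_x^j D̄₂` for `n = 2j + 1`. -/
def qAffPair (n : ℕ) : SF × SF →ₗ[ℂ] Op where
  toFun F :=
    if Even n then mulLeft F.1 * dx ^ (n / 2) + mulLeft F.2 * (dx ^ (n / 2 - 1) * Dbar₁ * Dbar₂)
    else mulLeft F.1 * (dx ^ (n / 2) * Dbar₁) + mulLeft F.2 * (dx ^ (n / 2) * Dbar₂)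
  map_add' F G := by split_ifs <;> simp [add_mul] <;> abel
  map_smul' c F := by split_ifs <;> simp

/-- The affine quantization map. -/
def qAff : Symbols →ₗ[ℂ] Op :=
  DirectSum.toModule ℂ ℕ Op fun n => (qAffPair n).comp (symbolPairs n).subtype

/-- `IsSymbol n D s`: the operator `D` has order at most `n / 2` and its class modulo operators
of lower order is the symbol `s`. -/
def IsSymbol (n : ℕ) (D : Op) (s : symbolPairs n) : Prop :=
  D ∈ diffOps n ∧ D - qAffPair n s ∈ lowerDiffOps n

/-- An `spo(2|2)`-equivariant quantization: a linear bijection from symbols to differential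
operators which preserves the principal symbol and intertwines the actions of `spo(2|2)`.
The action on symbols is `L_X [D] = [L_X D]`. -/
structure IsEquivariantQuantization (lam mu : ℂ) (Q : Symbols →ₗ[ℂ] Op) : Prop where
  injective : Function.Injective Q
  range_eq : LinearMap.range Q = allDiffOps
  symbol : ∀ (n : ℕ) (s : symbolPairs n),
    IsSymbol n (Q (DirectSum.lof ℂ ℕ (fun n => symbolPairs n) n s)) s
  equivariant : ∀ f ∈ spo, ∀ (n : ℕ) (s t : symbolPairs n),
    IsSymbol n (opLie lam mu f (qAffPair n s)) t →
      opLie lam mu f (Q (DirectSum.lof ℂ ℕ (fun n => symbolPairs n) n s)) =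
        Q (DirectSum.lof ℂ ℕ (fun n => symbolPairs n) n t)

/-- The number `α_k` with `n = 2k`: `(δ - k)²` for integer `k`, and `(δ - k)² - 1/4` for
half-integer `k`. -/
def alpha (δ : ℂ) (n : ℤ) : ℂ :=
  if Even n then (-(n / 2 : ℂ) + δ) ^ 2 else (-(n / 2 : ℂ) + δ) ^ 2 - 1 / 4

/-- The shift `δ` is critical if `α_k = α_l` for some half-natural numbers `l < k`. -/
def IsCritical (δ : ℂ) : Prop := ∃ m n : ℕ, m < n ∧ alpha δ n = alpha δ m

/-- The lift `T = S_k + S_(k-1/2) + ⋯ + S_0` of a symbol `S` of degree `k = n / 2`: its component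
of degree `k` is `S`, it has no components of higher degree, and it satisfies the eigenvalue
equation with eigenvalue `α_k` for the Casimir operator transported to symbols by `qAff`. -/
structure IsCasimirLift (lam mu : ℂ) (n : ℕ) (S : symbolPairs n) (T : Symbols) : Prop where
  top : T n = S
  above : ∀ m, n < m → T m = 0
  eigen : casimir lam mu (qAff T) = alpha (mu - lam) n • qAff T

/-- `A_i = -i`. -/
def coefA (i : ℂ) : ℂ := -i

/-- `B_i = -(i + 2 lam)`. -/
def coefB (lam i : ℂ) : ℂ := -(i + 2 * lam)

/-- The coefficient `C_l`, with `δ = mu - lam`. -/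
def coefC (lam mu : ℂ) (k l : ℕ) : ℂ :=
  (∏ i ∈ Finset.Icc 1 (l - 1), coefA ((k : ℂ) - i) * coefB lam ((k : ℂ) - i)) /
    ∏ i ∈ Finset.Icc 1 l, (alpha (mu - lam) (2 * k) - alpha (mu - lam) (2 * k - 2 * i))

/-- The coefficient `D_l`, with `δ = mu - lam`. -/
def coefD (lam mu : ℂ) (k l : ℕ) : ℂ :=
  (-l * ∏ i ∈ Finset.Icc 1 (l - 1), coefA ((k : ℂ) - i) * coefB lam ((k : ℂ) - i)) /
    (2 * (alpha (mu - lam) (2 * k) - alpha (mu - lam) (2 * k - 1)) *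
      ∏ i ∈ Finset.Icc 1 l, (alpha (mu - lam) (2 * k) - alpha (mu - lam) (2 * k - 2 * i)))

/-- The coefficient `E_l` for the half-integer `l = j + 1/2`, with `δ = mu - lam`. -/
def coefE (lam mu : ℂ) (k j : ℕ) : ℂ :=
  (∏ i ∈ Finset.Icc 1 j, coefA ((k : ℂ) - i) * coefB lam ((k : ℂ) - i)) /
    (2 * (alpha (mu - lam) (2 * k) - alpha (mu - lam) (2 * k - 1)) *
      ∏ i ∈ Finset.Icc 1 j, (alpha (mu - lam) (2 * k) - alpha (mu - lam) (2 * k - 2 * i)))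

/-- The action of a 2 × 2 matrix of operators on a pair of superfunctions. -/
def matAct (M : Matrix (Fin 2) (Fin 2) Op) (F : SF × SF) : SF × SF :=
  (M 0 0 F.1 + M 0 1 F.2, M 1 0 F.1 + M 1 1 F.2)

/-- The matrix that multiplies `C_l`. -/
def matC (lam : ℂ) (k l : ℕ) : Matrix (Fin 2) (Fin 2) Op :=
  !![(coefA k * coefB lam ((k : ℂ) - l)) • dx ^ l, 0;
     0, (coefA ((k : ℂ) - l) * coefB lam k) • dx ^ l]

/-- The matrix that multiplies `D_l`. -/
def matD (lam : ℂ) (k l : ℕ) : Matrix (Fin 2) (Fin 2) Op :=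
  !![(coefA k * coefB lam ((k : ℂ) - l)) • dx ^ l,
      -((coefB lam k * coefB lam ((k : ℂ) - l)) • (Dbar₁ * Dbar₂ * dx ^ (l - 1)));
     (coefA k * coefA ((k : ℂ) - l)) • (Dbar₁ * Dbar₂ * dx ^ (l - 1)),
      (coefA ((k : ℂ) - l) * coefB lam k) • dx ^ l]

/-- The matrix that multiplies `E_l` for `l = j + 1/2`. -/
def matE (lam : ℂ) (k j : ℕ) : Matrix (Fin 2) (Fin 2) Op :=
  !![coefA k • (Dbar₁ * dx ^ j), coefB lam k • (Dbar₂ * dx ^ j);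
     coefA k • (Dbar₂ * dx ^ j), -(coefB lam k • (Dbar₁ * dx ^ j))]

/-- The closed formulae for the lower components `S_(k-l)` of a lift `T` of `S ∈ 𝒮^k`. -/
structure HasExplicitComponents (lam mu : ℂ) (k : ℕ) (S : symbolPairs (2 * k)) (T : Symbols) :
    Prop where
  integer : ∀ l : ℕ, 1 ≤ l → l ≤ k →
    (T (2 * k - 2 * l) : SF × SF) =
      coefC lam mu k l • matAct (matC lam k l) S + coefD lam mu k l • matAct (matD lam k l) S
  half : ∀ p : Fin 2, SF.HasParity p S.1.1 → SF.HasParity p S.1.2 → ∀ j : ℕ, j < k →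
    (T (2 * k - (2 * j + 1)) : SF × SF) =
      ((-1) ^ (p : ℕ) * coefE lam mu k j) • matAct (matE lam k j) S

end

end SuperQuant

/-!
The Casimir operator of `spo(2|2)` acts on differential operators, and the affine quantization
carries this action to symbols. The point is that on symbols it is triangular: it multiplies the
component of degree `j` by `α_j` and adds terms of degrees `j - 1/2` and `j - 1` only.

To see this, operators are written in the normal form `(a + b D̄₁ + c D̄₂ + d D̄₁ D̄₂) ∂_x^k`.
The Hamiltonians of `spo(2|2)` have constant second derivative, so the Leibniz expansion of a Lie
derivative stops after the term with `∂_x^(k-1)` (`opLie_normalOp_mul_dx_pow`). This second term is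
present only for `xθ₁`, `xθ₂` and `x²`, whose duals lack it, so that the Casimir operator lowers
the power of `∂_x` by at most one as well (`casimir_normalOp_mul_dx_pow`). On symbols it becomes
`symbolCasimir`, with lower parts `halfDrop` and `unitDrop` (`casimir_qAff`).

As the affine quantization is injective (`qAff_injective`), the eigenvalue equation
`𝒞 Ŝ = α_k Ŝ` amounts to a two-step recursion that gives `(α_k - α_j) S_j` in terms of `S_(j+1/2)`
and `S_(j+1)` (`casimir_eq_smul_iff`). For noncritical `δ` the factors `α_k - α_j` do not vanish,
whence uniqueness (`IsCasimirLift.unique`). The closed formulae solve the recursion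
(`liftPair_rec_one`, `liftPair_rec_two`, `liftPair_rec_even`, `liftPair_rec_odd`), once the sign
`(-1)^p` for symbols of parity `p` is read as the grading involution; this proves existence and
the formulae at the same time (`isCasimirLift_lift`, `hasExplicitComponents_lift`).

An equivariant quantization `Q` commutes with the Casimir operators. On principal symbols of degree
`k` the Casimir operator is the scalar `α_k` (`isSymbol_casimir`), hence `Q(S)` is an eigenvector
for `α_k` with principal symbol `S`, that is, the affine quantization of a lift of `S`
(`IsEquivariantQuantization.exists_isCasimirLift`).
-/

namespace SuperQuant

noncomputable section

/-! ### Componentwise calculus of superfunctions -/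

namespace Smooth

@[simp] theorem D_one : Smooth.D 1 = 0 := by
  apply Subtype.ext
  funext t
  exact deriv_const t (1 : ℂ)

@[simp] theorem D_mul (f g : Smooth) :
    Smooth.D (f * g) = Smooth.D f * g + f * Smooth.D g := by
  apply Subtype.ext
  funext t
  exact deriv_mul (Smooth.differentiable f t) (Smooth.differentiable g t)

@[simp] theorem D_x : Smooth.D Smooth.x = 1 := by
  apply Subtype.ext
  funext t
  exact (Complex.ofRealCLM.hasDerivAt (x := t)).deriv

/-- Evaluation at a point. -/
def eval (t : ℝ) (f : Smooth) : ℂ := f.1 t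

theorem ext_eval {f g : Smooth} (h : ∀ t, eval t f = eval t g) : f = g :=
  Subtype.ext (funext h)

end Smooth

namespace SF

@[simp] theorem zero_c0 : (0 : SF).c0 = 0 := rfl
@[simp] theorem zero_c1 : (0 : SF).c1 = 0 := rfl
@[simp] theorem zero_c2 : (0 : SF).c2 = 0 := rfl
@[simp] theorem zero_c12 : (0 : SF).c12 = 0 := rfl
@[simp] theorem neg_c0 (f : SF) : (-f).c0 = -f.c0 := rfl
@[simp] theorem neg_c1 (f : SF) : (-f).c1 = -f.c1 := rfl
@[simp] theorem neg_c2 (f : SF) : (-f).c2 = -f.c2 := rfl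
@[simp] theorem neg_c12 (f : SF) : (-f).c12 = -f.c12 := rfl
@[simp] theorem sub_c0 (f g : SF) : (f - g).c0 = f.c0 - g.c0 := rfl
@[simp] theorem sub_c1 (f g : SF) : (f - g).c1 = f.c1 - g.c1 := rfl
@[simp] theorem sub_c2 (f g : SF) : (f - g).c2 = f.c2 - g.c2 := rfl
@[simp] theorem sub_c12 (f g : SF) : (f - g).c12 = f.c12 - g.c12 := rfl

end SF

@[simp] theorem mulLeft_apply (a b : SF) : mulLeft a b = a * b := rfl

@[simp] theorem dx_c0 (f : SF) : (dx f).c0 = Smooth.D f.c0 := rfl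
@[simp] theorem dx_c1 (f : SF) : (dx f).c1 = Smooth.D f.c1 := rfl
@[simp] theorem dx_c2 (f : SF) : (dx f).c2 = Smooth.D f.c2 := rfl
@[simp] theorem dx_c12 (f : SF) : (dx f).c12 = Smooth.D f.c12 := rfl
@[simp] theorem gradInv_c0 (f : SF) : (gradInv f).c0 = f.c0 := rfl
@[simp] theorem gradInv_c1 (f : SF) : (gradInv f).c1 = -f.c1 := rfl
@[simp] theorem gradInv_c2 (f : SF) : (gradInv f).c2 = -f.c2 := rfl
@[simp] theorem gradInv_c12 (f : SF) : (gradInv f).c12 = f.c12 := rfl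

/-- The components of the operations on superfunctions, as one family of rewriting rules. -/
theorem component_rules :
    ((∀ f g : SF, (f + g).c0 = f.c0 + g.c0) ∧ (∀ f g : SF, (f + g).c1 = f.c1 + g.c1) ∧
      (∀ f g : SF, (f + g).c2 = f.c2 + g.c2) ∧ (∀ f g : SF, (f + g).c12 = f.c12 + g.c12)) ∧
    ((∀ f g : SF, (f - g).c0 = f.c0 - g.c0) ∧ (∀ f g : SF, (f - g).c1 = f.c1 - g.c1) ∧
      (∀ f g : SF, (f - g).c2 = f.c2 - g.c2) ∧ (∀ f g : SF, (f - g).c12 = f.c12 - g.c12)) ∧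
    ((∀ f : SF, (-f).c0 = -f.c0) ∧ (∀ f : SF, (-f).c1 = -f.c1) ∧
      (∀ f : SF, (-f).c2 = -f.c2) ∧ (∀ f : SF, (-f).c12 = -f.c12)) ∧
    ((∀ (z : ℂ) (f : SF), (z • f).c0 = z • f.c0) ∧ (∀ (z : ℂ) (f : SF), (z • f).c1 = z • f.c1) ∧
      (∀ (z : ℂ) (f : SF), (z • f).c2 = z • f.c2) ∧
      (∀ (z : ℂ) (f : SF), (z • f).c12 = z • f.c12)) ∧
    ((∀ f g : SF, (f * g).c0 = f.c0 * g.c0) ∧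
      (∀ f g : SF, (f * g).c1 = f.c0 * g.c1 + f.c1 * g.c0) ∧
      (∀ f g : SF, (f * g).c2 = f.c0 * g.c2 + f.c2 * g.c0) ∧
      (∀ f g : SF, (f * g).c12 =
        f.c0 * g.c12 + f.c12 * g.c0 + (f.c1 * g.c2 - f.c2 * g.c1))) ∧
    ((∀ f : SF, f.evenPart.c0 = f.c0) ∧ (∀ f : SF, f.evenPart.c1 = 0) ∧
      (∀ f : SF, f.evenPart.c2 = 0) ∧ (∀ f : SF, f.evenPart.c12 = f.c12)) ∧
    ((∀ f : SF, f.oddPart.c0 = 0) ∧ (∀ f : SF, f.oddPart.c1 = f.c1) ∧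
      (∀ f : SF, f.oddPart.c2 = f.c2) ∧ (∀ f : SF, f.oddPart.c12 = 0)) := by
  refine ⟨⟨?_, ?_, ?_, ?_⟩, ⟨?_, ?_, ?_, ?_⟩, ⟨?_, ?_, ?_, ?_⟩, ⟨?_, ?_, ?_, ?_⟩,
    ⟨?_, ?_, ?_, ?_⟩, ⟨?_, ?_, ?_, ?_⟩, ⟨?_, ?_, ?_, ?_⟩⟩ <;> intros <;> rfl

/-- The components of the elementary operators, as one family of rewriting rules. -/
theorem derivative_rules :
    (∀ a b : SF, mulLeft a b = a * b) ∧
    ((∀ f, (dx f).c0 = Smooth.D f.c0) ∧ (∀ f, (dx f).c1 = Smooth.D f.c1) ∧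
      (∀ f, (dx f).c2 = Smooth.D f.c2) ∧ (∀ f, (dx f).c12 = Smooth.D f.c12)) ∧
    ((∀ f, (gradInv f).c0 = f.c0) ∧ (∀ f, (gradInv f).c1 = -f.c1) ∧
      (∀ f, (gradInv f).c2 = -f.c2) ∧ (∀ f, (gradInv f).c12 = f.c12)) ∧
    ((∀ f, (Dbar₁ f).c0 = f.c1) ∧ (∀ f, (Dbar₁ f).c1 = -Smooth.D f.c0) ∧
      (∀ f, (Dbar₁ f).c2 = f.c12) ∧ (∀ f, (Dbar₁ f).c12 = -Smooth.D f.c2)) ∧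
    ((∀ f, (Dbar₂ f).c0 = f.c2) ∧ (∀ f, (Dbar₂ f).c1 = -f.c12) ∧
      (∀ f, (Dbar₂ f).c2 = -Smooth.D f.c0) ∧ (∀ f, (Dbar₂ f).c12 = Smooth.D f.c1)) := by
  refine ⟨?_, ⟨?_, ?_, ?_, ?_⟩, ⟨?_, ?_, ?_, ?_⟩, ⟨?_, ?_, ?_, ?_⟩, ⟨?_, ?_, ?_, ?_⟩⟩ <;>
    intros <;> first | rfl | simp [Dbar₁, dθ₁, θ₁, Dbar₂, dθ₂, θ₂]

/-- Rewriting rules that compute derivatives of smooth functions and then evaluate at a point, which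
turns identities of superfunctions into identities in the commutative ring `ℂ`. -/
theorem Smooth.eval_rules :
    (∀ f g, Smooth.D (f + g) = Smooth.D f + Smooth.D g) ∧
    (∀ f g, Smooth.D (f - g) = Smooth.D f - Smooth.D g) ∧
    (∀ f, Smooth.D (-f) = -Smooth.D f) ∧
    (∀ f g, Smooth.D (f * g) = Smooth.D f * g + f * Smooth.D g) ∧
    (∀ (z : ℂ) f, Smooth.D (z • f) = z • Smooth.D f) ∧
    Smooth.D 0 = 0 ∧ Smooth.D 1 = 0 ∧ Smooth.D Smooth.x = 1 ∧
    (∀ t f g, eval t (f + g) = eval t f + eval t g) ∧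
    (∀ t f g, eval t (f - g) = eval t f - eval t g) ∧
    (∀ t f, eval t (-f) = -eval t f) ∧
    (∀ t f g, eval t (f * g) = eval t f * eval t g) ∧
    (∀ t (z : ℂ) f, eval t (z • f) = z * eval t f) ∧
    (∀ t, eval t 0 = 0) ∧ (∀ t, eval t 1 = 1) ∧ (∀ t, eval t Smooth.x = t) :=
  ⟨map_add _, map_sub _, map_neg _, Smooth.D_mul, map_smul _, map_zero _, Smooth.D_one,
    Smooth.D_x, fun _ _ _ => rfl, fun _ _ _ => rfl, fun _ _ => rfl, fun _ _ _ => rfl,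
    fun _ _ _ => rfl, fun _ => rfl, fun _ => rfl, fun _ => rfl⟩

theorem densityLie_apply (w : ℂ) (f g : SF) :
    densityLie w f g = f * dx g - (1 / 2 : ℂ) • (Dbar₁ (gradInv f) * Dbar₁ g +
      Dbar₂ (gradInv f) * Dbar₂ g) + w • (dx f * g) := rfl

/-- Equality of superfunctions may be tested componentwise and pointwise. -/
theorem SF.ext_eval {f g : SF} (h0 : ∀ t, Smooth.eval t f.c0 = Smooth.eval t g.c0)
    (h1 : ∀ t, Smooth.eval t f.c1 = Smooth.eval t g.c1)
    (h2 : ∀ t, Smooth.eval t f.c2 = Smooth.eval t g.c2)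
    (h12 : ∀ t, Smooth.eval t f.c12 = Smooth.eval t g.c12) : f = g :=
  SF.ext (Smooth.ext_eval h0) (Smooth.ext_eval h1) (Smooth.ext_eval h2) (Smooth.ext_eval h12)

theorem densityLie_add (w : ℂ) (f g : SF) :
    densityLie w (f + g) = densityLie w f + densityLie w g := by
  refine LinearMap.ext fun h => ?_
  refine SF.ext_eval ?_ ?_ ?_ ?_ <;> intro t <;>
    simp only [LinearMap.add_apply, component_rules, derivative_rules, Smooth.eval_rules,
      densityLie_apply] <;> ring

theorem Dbar₁_sq : Dbar₁ * Dbar₁ = -dx := by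
  refine LinearMap.ext fun h => ?_
  ext1 <;> simp [derivative_rules]

theorem Dbar₂_sq : Dbar₂ * Dbar₂ = -dx := by
  refine LinearMap.ext fun h => ?_
  ext1 <;> simp [derivative_rules]

theorem commute_dx_Dbar₁ : Commute dx Dbar₁ := by
  refine LinearMap.ext fun h => ?_
  ext1 <;> simp [derivative_rules]

theorem commute_dx_Dbar₂ : Commute dx Dbar₂ := by
  refine LinearMap.ext fun h => ?_
  ext1 <;> simp [derivative_rules]

theorem commute_dx_gradInv : Commute dx gradInv := by
  refine LinearMap.ext fun h => ?_
  ext1 <;> simp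

/-! ### Lie derivatives of operators in normal form -/

/-- Quadruples of coefficients of `1, D̄₁, D̄₂, D̄₁ D̄₂`. -/
abbrev Coeffs := SF × SF × SF × SF

/-- The operator `a + b D̄₁ + c D̄₂ + d D̄₁ D̄₂`. -/
def normalOp (q : Coeffs) : Op :=
  mulLeft q.1 + mulLeft q.2.1 * Dbar₁ + mulLeft q.2.2.1 * Dbar₂ +
    mulLeft q.2.2.2 * (Dbar₁ * Dbar₂)

theorem normalOp_apply (q : Coeffs) (g : SF) : normalOp q g =
    q.1 * g + q.2.1 * Dbar₁ g + q.2.2.1 * Dbar₂ g + q.2.2.2 * Dbar₁ (Dbar₂ g) := rfl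

theorem normalOp_add (q r : Coeffs) : normalOp (q + r) = normalOp q + normalOp r := by
  simp only [normalOp, Prod.fst_add, Prod.snd_add, map_add, add_mul]
  abel

theorem normalOp_smul (z : ℂ) (q : Coeffs) : normalOp (z • q) = z • normalOp q := by
  simp only [normalOp, Prod.smul_fst, Prod.smul_snd, map_smul, smul_mul_assoc, smul_add]

/-- The signed right product `(-1)^(f D) D ∘ L_f`, extended bilinearly. -/
def signedMul (D : Op) (lam : ℂ) (f : SF) : Op :=
  D * densityLie lam f.evenPart + gradInv * D * gradInv * densityLie lam f.oddPart

theorem opLie_eq (lam mu : ℂ) (f : SF) (D : Op) :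
    opLie lam mu f D = densityLie mu f * D - signedMul D lam f := by
  rw [opLie, signedMul]
  abel

/-- The derivation part `X_f a` of a Lie derivative. -/
def vec (f a : SF) : SF :=
  f * dx a - (1 / 2 : ℂ) • (Dbar₁ (gradInv f) * Dbar₁ a + Dbar₂ (gradInv f) * Dbar₂ a)

/-- The part of `signedMul (normalOp q) lam f` that is free of `∂_x`. -/
def signedCoeffs (lam : ℂ) (f : SF) (q : Coeffs) : Coeffs :=
  (lam • (dx f * q.1 + Dbar₁ (dx (gradInv f)) * gradInv q.2.1 +
      Dbar₂ (dx (gradInv f)) * gradInv q.2.2.1 + Dbar₁ (Dbar₂ (dx f)) * q.2.2.2),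
    -(1 / 2 : ℂ) • (Dbar₁ (gradInv f) * gradInv q.1) + (1 / 2 + lam) • (dx f * q.2.1) +
      (1 / 2 : ℂ) • (Dbar₁ (Dbar₂ f) * q.2.2.1) -
      (1 / 2 + lam) • (Dbar₂ (dx (gradInv f)) * gradInv q.2.2.2),
    -(1 / 2 : ℂ) • (Dbar₂ (gradInv f) * gradInv q.1) - (1 / 2 : ℂ) • (Dbar₁ (Dbar₂ f) * q.2.1) +
      (1 / 2 + lam) • (dx f * q.2.2.1) +
      (1 / 2 + lam) • (Dbar₁ (dx (gradInv f)) * gradInv q.2.2.2),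
    (1 / 2 : ℂ) • (Dbar₂ (gradInv f) * gradInv q.2.1) -
      (1 / 2 : ℂ) • (Dbar₁ (gradInv f) * gradInv q.2.2.1) + (1 + lam) • (dx f * q.2.2.2))

/-- The coefficient of `∂_x` in `signedMul (normalOp q) lam f`. -/
def signedCoeffsDx (f : SF) (q : Coeffs) : Coeffs :=
  (f * q.1 + (1 / 2 : ℂ) • (Dbar₁ (gradInv f) * gradInv q.2.1 +
      Dbar₂ (gradInv f) * gradInv q.2.2.1),
    f * q.2.1 - (1 / 2 : ℂ) • (Dbar₂ (gradInv f) * gradInv q.2.2.2),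
    f * q.2.2.1 + (1 / 2 : ℂ) • (Dbar₁ (gradInv f) * gradInv q.2.2.2),
    f * q.2.2.2)

set_option maxHeartbeats 4000000 in
theorem signedMul_normalOp (lam : ℂ) (f : SF) (q : Coeffs) :
    signedMul (normalOp q) lam f =
      normalOp (signedCoeffs lam f q) + normalOp (signedCoeffsDx f q) * dx := by
  obtain ⟨a, b, c, d⟩ := q
  refine LinearMap.ext fun g => ?_
  refine SF.ext_eval ?_ ?_ ?_ ?_ <;> intro t <;>
    simp only [LinearMap.add_apply, Module.End.mul_apply, component_rules,
      derivative_rules, Smooth.eval_rules, signedMul, normalOp_apply, densityLie_apply,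
      signedCoeffs, signedCoeffsDx] <;> ring

/-- The coefficients of `opLie lam mu f (normalOp q)`. -/
def lieCoeffs (lam mu : ℂ) (f : SF) (q : Coeffs) : Coeffs :=
  (vec f q.1 + (mu - lam) • (dx f * q.1) - lam • (Dbar₁ (dx (gradInv f)) * gradInv q.2.1 +
      Dbar₂ (dx (gradInv f)) * gradInv q.2.2.1 + Dbar₁ (Dbar₂ (dx f)) * q.2.2.2),
    vec f q.2.1 + (mu - lam - 1 / 2) • (dx f * q.2.1) -
      (1 / 2 : ℂ) • (Dbar₁ (Dbar₂ f) * q.2.2.1) +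
      (1 / 2 + lam) • (Dbar₂ (dx (gradInv f)) * gradInv q.2.2.2),
    vec f q.2.2.1 + (mu - lam - 1 / 2) • (dx f * q.2.2.1) +
      (1 / 2 : ℂ) • (Dbar₁ (Dbar₂ f) * q.2.1) -
      (1 / 2 + lam) • (Dbar₁ (dx (gradInv f)) * gradInv q.2.2.2),
    vec f q.2.2.2 + (mu - lam - 1) • (dx f * q.2.2.2))

set_option maxHeartbeats 4000000 in
/-- The terms with `∂_x` cancel: the Lie derivative of an operator of the form
`a + b D̄₁ + c D̄₂ + d D̄₁ D̄₂` has the same form. -/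
theorem opLie_normalOp (lam mu : ℂ) (f : SF) (q : Coeffs) :
    opLie lam mu f (normalOp q) = normalOp (lieCoeffs lam mu f q) := by
  obtain ⟨a, b, c, d⟩ := q
  refine LinearMap.ext fun g => ?_
  refine SF.ext_eval ?_ ?_ ?_ ?_ <;> intro t <;>
    simp only [LinearMap.sub_apply, Module.End.mul_apply, component_rules,
      derivative_rules, Smooth.eval_rules, opLie, normalOp_apply, densityLie_apply,
      lieCoeffs, vec] <;> ring

theorem dx_mul_densityLie (w : ℂ) (f : SF) :
    dx * densityLie w f = densityLie w f * dx + densityLie w (dx f) := by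
  refine LinearMap.ext fun h => ?_
  refine SF.ext_eval ?_ ?_ ?_ ?_ <;> intro t <;>
    simp only [LinearMap.add_apply, Module.End.mul_apply, component_rules, derivative_rules,
      Smooth.eval_rules, densityLie_apply] <;> ring

theorem densityLie_zero (w : ℂ) : densityLie w 0 = 0 := by
  have h := densityLie_add w 0 0
  rw [add_zero] at h
  simpa using h

theorem natCast_smul_dx_mul_pow (k : ℕ) :
    (k : ℂ) • (dx * dx ^ (k - 1)) = (k : ℂ) • dx ^ k := by
  cases k with
  | zero => simp
  | succ k => rw [Nat.add_sub_cancel, pow_succ']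

theorem natCast_smul_dx_mul_pow_sub_two (k : ℕ) :
    ((k : ℂ) * (k - 1)) • (dx * dx ^ (k - 2)) = ((k : ℂ) * (k - 1)) • dx ^ (k - 1) := by
  rcases k with _ | _ | k
  · simp
  · simp
  · rw [← pow_succ']
    rfl

/-- Moving a power of `∂_x` past a Lie derivative; the Leibniz expansion stops since the third
derivative of the Hamiltonian vanishes. -/
theorem dx_pow_mul_densityLie (w : ℂ) {f : SF} (hf : dx (dx (dx f)) = 0) (k : ℕ) :
    dx ^ k * densityLie w f = densityLie w f * dx ^ k +
      (k : ℂ) • (densityLie w (dx f) * dx ^ (k - 1)) +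
      ((k : ℂ) * (k - 1) / 2) • (densityLie w (dx (dx f)) * dx ^ (k - 2)) := by
  induction k with
  | zero => simp
  | succ k ih =>
    have h1 := natCast_smul_dx_mul_pow k
    have h2 := natCast_smul_dx_mul_pow_sub_two k
    have h3 : dx * densityLie w (dx (dx f)) = densityLie w (dx (dx f)) * dx := by
      rw [dx_mul_densityLie, hf, densityLie_zero, add_zero]
    have e1 : (k : ℂ) • (dx * (densityLie w (dx f) * dx ^ (k - 1))) =
        (k : ℂ) • (densityLie w (dx f) * dx ^ k) +
          (k : ℂ) • (densityLie w (dx (dx f)) * dx ^ (k - 1)) := by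
      rw [← mul_assoc, dx_mul_densityLie, add_mul, smul_add, mul_assoc, ← mul_smul_comm, h1,
        mul_smul_comm]
    have e2 : ((k : ℂ) * (k - 1) / 2) • (dx * (densityLie w (dx (dx f)) * dx ^ (k - 2))) =
        ((k : ℂ) * (k - 1) / 2) • (densityLie w (dx (dx f)) * dx ^ (k - 1)) := by
      rw [← mul_assoc, h3, mul_assoc, div_eq_inv_mul, mul_smul, ← mul_smul_comm, h2,
        mul_smul_comm, mul_smul _ ((k : ℂ) * (k - 1))]
    rw [pow_succ', mul_assoc, ih, mul_add, mul_add, mul_smul_comm, mul_smul_comm, e1, e2,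
      ← mul_assoc, dx_mul_densityLie, add_mul, mul_assoc]
    have e3 : k + 1 - 2 = k - 1 := by omega
    rw [Nat.add_sub_cancel, e3]
    push_cast
    module

/-- Parity does not interfere with `∂_x`, so the signed product obeys the same Leibniz rule. -/
theorem signedMul_mul_dx_pow (D : Op) (lam : ℂ) {f : SF} (hf : dx (dx (dx f)) = 0) (k : ℕ) :
    signedMul (D * dx ^ k) lam f = signedMul D lam f * dx ^ k +
      (k : ℂ) • (signedMul D lam (dx f) * dx ^ (k - 1)) +
      ((k : ℂ) * (k - 1) / 2) • (signedMul D lam (dx (dx f)) * dx ^ (k - 2)) := by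
  have ev (g : SF) : (dx g).evenPart = dx g.evenPart := by
    ext1 <;> simp [component_rules]
  have od (g : SF) : (dx g).oddPart = dx g.oddPart := by
    ext1 <;> simp [component_rules]
  have h0 : dx (dx (dx f.evenPart)) = 0 := by
    rw [← ev, ← ev, ← ev, hf]
    rfl
  have h1 : dx (dx (dx f.oddPart)) = 0 := by
    rw [← od, ← od, ← od, hf]
    rfl
  have hc : dx ^ k * gradInv = gradInv * dx ^ k := (commute_dx_gradInv.pow_left k).eq
  have e : gradInv * (D * dx ^ k) * gradInv = gradInv * D * gradInv * dx ^ k := by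
    rw [← mul_assoc, mul_assoc _ (dx ^ k), hc, ← mul_assoc]
  rw [signedMul, e, mul_assoc D, mul_assoc _ (dx ^ k), dx_pow_mul_densityLie _ h0,
    dx_pow_mul_densityLie _ h1]
  simp only [signedMul, ev, od, mul_add, add_mul, smul_add, mul_smul_comm, mul_assoc]
  abel

/-- The coefficient of `∂_x^k` in the Lie derivative of `normalOp q * ∂_x^k`. -/
def lieTop (lam mu k : ℂ) (f : SF) (q : Coeffs) : Coeffs :=
  lieCoeffs lam mu f q - k • signedCoeffsDx (dx f) q

/-- `k` times this is the coefficient of `∂_x^(k-1)` in the Lie derivative of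
`normalOp q * ∂_x^k`. -/
def lieLow (lam k : ℂ) (f : SF) (q : Coeffs) : Coeffs :=
  -signedCoeffs lam (dx f) q - ((k - 1) / 2) • signedCoeffsDx (dx (dx f)) q

theorem normalOp_neg (q : Coeffs) : normalOp (-q) = -normalOp q := by
  rw [← neg_one_smul ℂ, normalOp_smul, neg_one_smul]

theorem normalOp_sub (q r : Coeffs) : normalOp (q - r) = normalOp q - normalOp r := by
  rw [sub_eq_add_neg, normalOp_add, normalOp_neg, sub_eq_add_neg]

/-- For Hamiltonians of degree at most two in `x`, the Lie derivative of an operator in normal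
form lowers the power of `∂_x` by at most one. -/
theorem opLie_normalOp_mul_dx_pow (lam mu : ℂ) {f : SF} {z : ℂ}
    (hf : dx (dx f) = z • (⟨1, 0, 0, 0⟩ : SF)) (q : Coeffs) (k : ℕ) :
    opLie lam mu f (normalOp q * dx ^ k) = normalOp (lieTop lam mu k f q) * dx ^ k +
      (k : ℂ) • (normalOp (lieLow lam k f q) * dx ^ (k - 1)) := by
  have hone : dx (⟨1, 0, 0, 0⟩ : SF) = 0 := by
    ext1 <;> simp
  have h3 : dx (dx (dx f)) = 0 := by
    rw [hf, map_smul, hone, smul_zero]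
  have hlow : signedCoeffs lam (dx (dx f)) q = 0 := by
    rw [hf]
    ext1
    · refine SF.ext_eval ?_ ?_ ?_ ?_ <;> intro t <;>
      simp [derivative_rules, Smooth.eval_rules, signedCoeffs]
    ext1
    · refine SF.ext_eval ?_ ?_ ?_ ?_ <;> intro t <;>
      simp [derivative_rules, Smooth.eval_rules, signedCoeffs]
    ext1 <;>
    · refine SF.ext_eval ?_ ?_ ?_ ?_ <;> intro t <;>
      simp [derivative_rules, Smooth.eval_rules, signedCoeffs]
  have hzero : normalOp 0 = 0 := by simp [normalOp]
  have h1 := natCast_smul_dx_mul_pow k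
  have h2 := natCast_smul_dx_mul_pow_sub_two k
  rw [opLie_eq, signedMul_mul_dx_pow _ _ h3, ← mul_assoc, signedMul_normalOp _ (dx f),
    signedMul_normalOp _ (dx (dx f)), hlow, hzero, zero_add, mul_assoc _ dx, div_eq_inv_mul,
    mul_smul, ← mul_smul_comm _ _ (dx * dx ^ (k - 2)), h2, add_mul, smul_add, mul_assoc _ dx,
    ← mul_smul_comm _ _ (dx * dx ^ (k - 1)), h1, lieTop, lieLow, normalOp_sub, normalOp_sub,
    normalOp_neg, normalOp_smul, normalOp_smul, ← opLie_normalOp, opLie_eq]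
  simp only [sub_mul, neg_mul, smul_mul_assoc, mul_smul_comm]
  module

theorem opLie_smul_left (lam mu z : ℂ) (f : SF) (D : Op) :
    opLie lam mu (z • f) D = z • opLie lam mu f D := by
  have hL (w : ℂ) (h : SF) : densityLie w (z • h) = z • densityLie w h := by
    refine LinearMap.ext fun g => ?_
    refine SF.ext_eval ?_ ?_ ?_ ?_ <;> intro t <;>
      simp only [LinearMap.smul_apply, component_rules, derivative_rules, Smooth.eval_rules,
        densityLie_apply] <;> ring
  have h0 : (z • f).evenPart = z • f.evenPart := by ext1 <;> simp [component_rules]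
  have h1 : (z • f).oddPart = z • f.oddPart := by ext1 <;> simp [component_rules]
  simp only [opLie, h0, h1, hL, smul_mul_assoc, mul_smul_comm, smul_sub]

theorem opLie_add (lam mu : ℂ) (f : SF) (D E : Op) :
    opLie lam mu f (D + E) = opLie lam mu f D + opLie lam mu f E := by
  simp only [opLie, mul_add, add_mul]
  abel

theorem opLie_smul (lam mu : ℂ) (f : SF) (z : ℂ) (D : Op) :
    opLie lam mu f (z • D) = z • opLie lam mu f D := by
  simp only [opLie, smul_mul_assoc, mul_smul_comm, smul_sub]

/-! ### The generators of `spo(2|2)` -/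

/-- The components of the generators of `spo(2|2)`, as rewriting rules. -/
theorem spoGen_rules :
    ((spoGen 0).c0 = 1 ∧ (spoGen 0).c1 = 0 ∧ (spoGen 0).c2 = 0 ∧ (spoGen 0).c12 = 0) ∧
    ((spoGen 1).c0 = 0 ∧ (spoGen 1).c1 = 1 ∧ (spoGen 1).c2 = 0 ∧ (spoGen 1).c12 = 0) ∧
    ((spoGen 2).c0 = 0 ∧ (spoGen 2).c1 = 0 ∧ (spoGen 2).c2 = 1 ∧ (spoGen 2).c12 = 0) ∧
    ((spoGen 3).c0 = Smooth.x ∧ (spoGen 3).c1 = 0 ∧ (spoGen 3).c2 = 0 ∧ (spoGen 3).c12 = 0) ∧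
    ((spoGen 4).c0 = 0 ∧ (spoGen 4).c1 = 0 ∧ (spoGen 4).c2 = 0 ∧ (spoGen 4).c12 = 1) ∧
    ((spoGen 5).c0 = 0 ∧ (spoGen 5).c1 = Smooth.x ∧ (spoGen 5).c2 = 0 ∧ (spoGen 5).c12 = 0) ∧
    ((spoGen 6).c0 = 0 ∧ (spoGen 6).c1 = 0 ∧ (spoGen 6).c2 = Smooth.x ∧ (spoGen 6).c12 = 0) ∧
    ((spoGen 7).c0 = Smooth.x * Smooth.x ∧ (spoGen 7).c1 = 0 ∧ (spoGen 7).c2 = 0 ∧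
      (spoGen 7).c12 = 0) := by
  refine ⟨⟨rfl, rfl, rfl, rfl⟩, ⟨rfl, rfl, rfl, rfl⟩, ⟨rfl, rfl, rfl, rfl⟩, ⟨rfl, rfl, rfl, rfl⟩,
    ⟨rfl, rfl, rfl, rfl⟩, ⟨rfl, rfl, rfl, rfl⟩, ⟨rfl, rfl, rfl, rfl⟩, ⟨pow_two _, rfl, rfl, rfl⟩⟩

/-- Stated for an arbitrary type so that the entries of `spoDual` can be read off without the
generators being unfolded. -/
theorem vec_eight_apply {α : Type*} (a₀ a₁ a₂ a₃ a₄ a₅ a₆ a₇ : α) :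
    ![a₀, a₁, a₂, a₃, a₄, a₅, a₆, a₇] 0 = a₀ ∧ ![a₀, a₁, a₂, a₃, a₄, a₅, a₆, a₇] 1 = a₁ ∧
    ![a₀, a₁, a₂, a₃, a₄, a₅, a₆, a₇] 2 = a₂ ∧ ![a₀, a₁, a₂, a₃, a₄, a₅, a₆, a₇] 3 = a₃ ∧
    ![a₀, a₁, a₂, a₃, a₄, a₅, a₆, a₇] 4 = a₄ ∧ ![a₀, a₁, a₂, a₃, a₄, a₅, a₆, a₇] 5 = a₅ ∧
    ![a₀, a₁, a₂, a₃, a₄, a₅, a₆, a₇] 6 = a₆ ∧ ![a₀, a₁, a₂, a₃, a₄, a₅, a₆, a₇] 7 = a₇ :=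
  ⟨rfl, rfl, rfl, rfl, rfl, rfl, rfl, rfl⟩

theorem spoDual_rules :
    spoDual 0 = -((1 / 2 : ℂ) • spoGen 7) ∧ spoDual 1 = -spoGen 5 ∧ spoDual 2 = -spoGen 6 ∧
    spoDual 3 = spoGen 3 ∧ spoDual 4 = spoGen 4 ∧ spoDual 5 = spoGen 1 ∧
    spoDual 6 = spoGen 2 ∧ spoDual 7 = -((1 / 2 : ℂ) • spoGen 0) := by
  rw [spoDual]
  exact vec_eight_apply _ _ _ _ _ _ _ _

/-- Coefficients may be compared componentwise. -/
theorem coeffs_ext {q r : Coeffs} (ha : q.1 = r.1) (hb : q.2.1 = r.2.1) (hc : q.2.2.1 = r.2.2.1)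
    (hd : q.2.2.2 = r.2.2.2) : q = r :=
  Prod.ext ha (Prod.ext hb (Prod.ext hc hd))

/-- The vector field parts of the generators of `spo(2|2)` in components. -/
theorem vec_spoGen (g : SF) :
    vec (spoGen 0) g = dx g ∧
    vec (spoGen 1) g = (1 / 2 : ℂ) • ⟨g.c1, Smooth.D g.c0, g.c12, Smooth.D g.c2⟩ ∧
    vec (spoGen 2) g = (1 / 2 : ℂ) • ⟨g.c2, -g.c12, Smooth.D g.c0, -Smooth.D g.c1⟩ ∧
    vec (spoGen 3) g = ⟨Smooth.x * Smooth.D g.c0, Smooth.x * Smooth.D g.c1 + (1 / 2 : ℂ) • g.c1,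
      Smooth.x * Smooth.D g.c2 + (1 / 2 : ℂ) • g.c2, Smooth.x * Smooth.D g.c12 + g.c12⟩ ∧
    vec (spoGen 4) g = (1 / 2 : ℂ) • ⟨0, g.c2, -g.c1, 0⟩ ∧
    vec (spoGen 5) g = (1 / 2 : ℂ) • ⟨Smooth.x * g.c1, Smooth.x * Smooth.D g.c0,
      Smooth.x * g.c12, Smooth.x * Smooth.D g.c2 + g.c2⟩ ∧
    vec (spoGen 6) g = (1 / 2 : ℂ) • ⟨Smooth.x * g.c2, -(Smooth.x * g.c12),
      Smooth.x * Smooth.D g.c0, -(Smooth.x * Smooth.D g.c1 + g.c1)⟩ ∧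
    vec (spoGen 7) g = ⟨Smooth.x * (Smooth.x * Smooth.D g.c0),
      Smooth.x * (Smooth.x * Smooth.D g.c1 + g.c1), Smooth.x * (Smooth.x * Smooth.D g.c2 + g.c2),
      Smooth.x * (Smooth.x * Smooth.D g.c12 + (2 : ℂ) • g.c12)⟩ := by
  refine ⟨?_, ?_, ?_, ?_, ?_, ?_, ?_, ?_⟩ <;> refine SF.ext_eval ?_ ?_ ?_ ?_ <;> intro t <;>
    simp only [vec, component_rules, derivative_rules, Smooth.eval_rules, spoGen_rules,
      zero_mul, add_zero, zero_add, sub_zero, zero_sub, neg_zero, smul_zero, mul_one, one_mul] <;>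
    ring

set_option maxHeartbeats 1000000 in
set_option linter.unusedSimpArgs false in
theorem lieTop_spoGen (lam mu k : ℂ) (q : Coeffs) :
    lieTop lam mu k (spoGen 0) q =
      (vec (spoGen 0) q.1,
      vec (spoGen 0) q.2.1,
      vec (spoGen 0) q.2.2.1,
      vec (spoGen 0) q.2.2.2) ∧
    lieTop lam mu k (spoGen 1) q =
      (vec (spoGen 1) q.1,
      vec (spoGen 1) q.2.1,
      vec (spoGen 1) q.2.2.1,
      vec (spoGen 1) q.2.2.2) ∧
    lieTop lam mu k (spoGen 2) q =
      (vec (spoGen 2) q.1,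
      vec (spoGen 2) q.2.1,
      vec (spoGen 2) q.2.2.1,
      vec (spoGen 2) q.2.2.2) ∧
    lieTop lam mu k (spoGen 3) q =
      (vec (spoGen 3) q.1 + (mu - lam - k) • q.1,
      vec (spoGen 3) q.2.1 + (mu - lam - 1 / 2 - k) • q.2.1,
      vec (spoGen 3) q.2.2.1 + (mu - lam - 1 / 2 - k) • q.2.2.1,
      vec (spoGen 3) q.2.2.2 + (mu - lam - 1 - k) • q.2.2.2) ∧
    lieTop lam mu k (spoGen 4) q =
      (vec (spoGen 4) q.1,
      vec (spoGen 4) q.2.1 + (1 / 2 : ℂ) • q.2.2.1,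
      vec (spoGen 4) q.2.2.1 - (1 / 2 : ℂ) • q.2.1,
      vec (spoGen 4) q.2.2.2) ∧
    lieTop lam mu k (spoGen 5) q =
      (vec (spoGen 5) q.1 + (mu - lam - k) • (spoGen 1 * q.1) + (lam + k / 2) • gradInv q.2.1,
      vec (spoGen 5) q.2.1 + (mu - lam - 1 / 2 - k) • (spoGen 1 * q.2.1) -
        (1 / 2 : ℂ) • (spoGen 2 * q.2.2.1),
      vec (spoGen 5) q.2.2.1 + (mu - lam - 1 / 2 - k) • (spoGen 1 * q.2.2.1) +
        (1 / 2 : ℂ) • (spoGen 2 * q.2.1) +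
        (1 / 2 + lam + k / 2) • gradInv q.2.2.2,
      vec (spoGen 5) q.2.2.2 + (mu - lam - 1 - k) • (spoGen 1 * q.2.2.2)) ∧
    lieTop lam mu k (spoGen 6) q =
      (vec (spoGen 6) q.1 + (mu - lam - k) • (spoGen 2 * q.1) + (lam + k / 2) • gradInv q.2.2.1,
      vec (spoGen 6) q.2.1 + (mu - lam - 1 / 2 - k) • (spoGen 2 * q.2.1) +
        (1 / 2 : ℂ) • (spoGen 1 * q.2.2.1) -
        (1 / 2 + lam + k / 2) • gradInv q.2.2.2,
      vec (spoGen 6) q.2.2.1 + (mu - lam - 1 / 2 - k) • (spoGen 2 * q.2.2.1) -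
        (1 / 2 : ℂ) • (spoGen 1 * q.2.1),
      vec (spoGen 6) q.2.2.2 + (mu - lam - 1 - k) • (spoGen 2 * q.2.2.2)) ∧
    lieTop lam mu k (spoGen 7) q =
      (vec (spoGen 7) q.1 + (2 * (mu - lam - k)) • (spoGen 3 * q.1) +
        (2 * lam + k) • (spoGen 1 * gradInv q.2.1 + spoGen 2 * gradInv q.2.2.1),
      vec (spoGen 7) q.2.1 + (2 * (mu - lam - 1 / 2 - k)) • (spoGen 3 * q.2.1) -
        spoGen 4 * q.2.2.1 - (1 + 2 * lam + k) • (spoGen 2 * gradInv q.2.2.2),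
      vec (spoGen 7) q.2.2.1 + (2 * (mu - lam - 1 / 2 - k)) • (spoGen 3 * q.2.2.1) +
        spoGen 4 * q.2.1 + (1 + 2 * lam + k) • (spoGen 1 * gradInv q.2.2.2),
      vec (spoGen 7) q.2.2.2 + (2 * (mu - lam - 1 - k)) • (spoGen 3 * q.2.2.2)) := by
  refine ⟨?_, ?_, ?_, ?_, ?_, ?_, ?_, ?_⟩ <;>
    refine coeffs_ext ?_ ?_ ?_ ?_ <;> simp only [lieTop, lieCoeffs, signedCoeffsDx,
      Prod.fst_add, Prod.fst_sub, Prod.fst_neg, Prod.smul_fst, Prod.snd_add, Prod.snd_sub,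
      Prod.snd_neg, Prod.smul_snd] <;>
    refine SF.ext_eval ?_ ?_ ?_ ?_ <;> intro t <;>
    simp only [component_rules, derivative_rules, Smooth.eval_rules, spoGen_rules, mul_zero,
      zero_mul, add_zero, zero_add, sub_zero, zero_sub, neg_zero, smul_zero, mul_one,
      one_mul] <;> ring

set_option maxHeartbeats 1000000 in
set_option linter.unusedSimpArgs false in
theorem lieLow_spoGen (lam k : ℂ) (q : Coeffs) :
    lieLow lam k (spoGen 0) q = 0 ∧
    lieLow lam k (spoGen 1) q = 0 ∧
    lieLow lam k (spoGen 2) q = 0 ∧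
    lieLow lam k (spoGen 3) q = 0 ∧
    lieLow lam k (spoGen 4) q = 0 ∧
    lieLow lam k (spoGen 5) q =
      (0,
      -(1 / 2 : ℂ) • gradInv q.1,
      0,
      -(1 / 2 : ℂ) • gradInv q.2.2.1) ∧
    lieLow lam k (spoGen 6) q =
      (0,
      0,
      -(1 / 2 : ℂ) • gradInv q.1,
      (1 / 2 : ℂ) • gradInv q.2.1) ∧
    lieLow lam k (spoGen 7) q =
      (-(2 * lam + k - 1) • q.1,
      -(spoGen 1 * gradInv q.1) - (2 * lam + k) • q.2.1,
      -(spoGen 2 * gradInv q.1) - (2 * lam + k) • q.2.2.1,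
      spoGen 2 * gradInv q.2.1 - spoGen 1 * gradInv q.2.2.1 -
        (1 + 2 * lam + k) • q.2.2.2) := by
  refine ⟨?_, ?_, ?_, ?_, ?_, ?_, ?_, ?_⟩ <;>
    refine coeffs_ext ?_ ?_ ?_ ?_ <;> simp only [lieLow, signedCoeffs, signedCoeffsDx,
      Prod.fst_add, Prod.fst_sub, Prod.fst_neg, Prod.smul_fst, Prod.snd_add, Prod.snd_sub,
      Prod.snd_neg, Prod.smul_snd,
      Prod.fst_zero, Prod.snd_zero] <;>
    refine SF.ext_eval ?_ ?_ ?_ ?_ <;> intro t <;>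
    simp only [component_rules, SF.zero_c0, SF.zero_c1, SF.zero_c2, SF.zero_c12, derivative_rules,
      Smooth.eval_rules, spoGen_rules, mul_zero, zero_mul, add_zero, zero_add, sub_zero,
      zero_sub, neg_zero, smul_zero, mul_one, one_mul] <;> ring

/-! ### The Casimir operator in normal form -/

/-- The coefficient of `∂_x^k` in the Casimir operator applied to `normalOp q * ∂_x^k`. -/
def casimirTop (lam mu k : ℂ) (q : Coeffs) : Coeffs :=
  ((mu - lam - k) ^ 2 • q.1 - ((k + 2 * lam) / 2) • gradInv (Dbar₁ q.2.1 + Dbar₂ q.2.2.1),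
    ((mu - lam - k - 1 / 2) ^ 2 - 1 / 4) • q.2.1 -
      ((k + 1 + 2 * lam) / 2) • Dbar₂ (gradInv q.2.2.2),
    ((mu - lam - k - 1 / 2) ^ 2 - 1 / 4) • q.2.2.1 +
      ((k + 1 + 2 * lam) / 2) • Dbar₁ (gradInv q.2.2.2),
    (mu - lam - k - 1) ^ 2 • q.2.2.2)

/-- `k` times this is the coefficient of `∂_x^(k-1)` in the Casimir operator applied to
`normalOp q * ∂_x^k`. -/
def casimirLow (lam k : ℂ) (q : Coeffs) : Coeffs :=
  ((k - 1 + 2 * lam) • dx q.1,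
    -(1 / 2 : ℂ) • Dbar₁ (gradInv q.1) + (k + 2 * lam) • dx q.2.1,
    -(1 / 2 : ℂ) • Dbar₂ (gradInv q.1) + (k + 2 * lam) • dx q.2.2.1,
    -(1 / 2 : ℂ) • gradInv (Dbar₂ q.2.1 - Dbar₁ q.2.2.1) + (k + 1 + 2 * lam) • dx q.2.2.2)

set_option maxHeartbeats 4000000 in
set_option linter.unusedSimpArgs false in
/-- The contributions to `∂_x^k` in the Casimir operator: for each pair of dual generators, both
factors keep the power. -/
theorem casimirTop_eq (lam mu k : ℂ) (q : Coeffs) : casimirTop lam mu k q =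
    -(1 / 2 : ℂ) • lieTop lam mu k (spoGen 7) (lieTop lam mu k (spoGen 0) q) -
      lieTop lam mu k (spoGen 5) (lieTop lam mu k (spoGen 1) q) -
      lieTop lam mu k (spoGen 6) (lieTop lam mu k (spoGen 2) q) +
      lieTop lam mu k (spoGen 3) (lieTop lam mu k (spoGen 3) q) +
      lieTop lam mu k (spoGen 4) (lieTop lam mu k (spoGen 4) q) +
      lieTop lam mu k (spoGen 1) (lieTop lam mu k (spoGen 5) q) +
      lieTop lam mu k (spoGen 2) (lieTop lam mu k (spoGen 6) q) -
      (1 / 2 : ℂ) • lieTop lam mu k (spoGen 0) (lieTop lam mu k (spoGen 7) q) := by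
  simp only [lieTop_spoGen]
  refine coeffs_ext ?_ ?_ ?_ ?_ <;> simp only [casimirTop, vec_spoGen,
      Prod.fst_add, Prod.fst_sub, Prod.fst_neg, Prod.smul_fst, Prod.snd_add, Prod.snd_sub,
      Prod.snd_neg, Prod.smul_snd] <;>
    refine SF.ext_eval ?_ ?_ ?_ ?_ <;> intro t <;>
    simp only [component_rules, derivative_rules, Smooth.eval_rules, spoGen_rules, mul_zero,
      zero_mul, add_zero, zero_add, sub_zero, zero_sub, neg_zero, smul_zero, mul_one,
      one_mul] <;> ring

set_option maxHeartbeats 4000000 in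
set_option linter.unusedSimpArgs false in
/-- The contributions to `∂_x^(k-1)` in the Casimir operator: the power drops once, and only the
Hamiltonians `xθ₁`, `xθ₂`, `x²` can lower it. If one of them acts first, its dual acts on an
operator with `∂_x^(k-1)`. -/
theorem casimirLow_eq (lam mu k : ℂ) (q : Coeffs) : casimirLow lam k q =
    -(1 / 2 : ℂ) • lieLow lam k (spoGen 7) (lieTop lam mu k (spoGen 0) q) -
      lieLow lam k (spoGen 5) (lieTop lam mu k (spoGen 1) q) -
      lieLow lam k (spoGen 6) (lieTop lam mu k (spoGen 2) q) +
      lieTop lam mu (k - 1) (spoGen 1) (lieLow lam k (spoGen 5) q) +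
      lieTop lam mu (k - 1) (spoGen 2) (lieLow lam k (spoGen 6) q) -
      (1 / 2 : ℂ) • lieTop lam mu (k - 1) (spoGen 0) (lieLow lam k (spoGen 7) q) := by
  simp only [lieTop_spoGen, lieLow_spoGen]
  refine coeffs_ext ?_ ?_ ?_ ?_ <;> simp only [casimirLow, vec_spoGen,
      Prod.fst_add, Prod.fst_sub, Prod.fst_neg, Prod.smul_fst, Prod.snd_add, Prod.snd_sub,
      Prod.snd_neg, Prod.smul_snd] <;>
    refine SF.ext_eval ?_ ?_ ?_ ?_ <;> intro t <;>
    simp only [component_rules, SF.zero_c0, SF.zero_c1, SF.zero_c2, SF.zero_c12, derivative_rules,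
      Smooth.eval_rules, spoGen_rules, mul_zero, zero_mul, add_zero, zero_add, sub_zero,
      zero_sub, neg_zero, smul_zero, mul_one, one_mul] <;> ring

/-- Hamiltonians of `spo(2|2)` have constant second derivative. -/
theorem dx_dx_eq_smul_one {f : SF} (hf : f ∈ spo) :
    ∃ z : ℂ, dx (dx f) = z • (⟨1, 0, 0, 0⟩ : SF) := by
  induction hf using Submodule.span_induction with
  | mem f hf =>
    obtain ⟨i, rfl⟩ := hf
    refine ⟨if i = 7 then 2 else 0, ?_⟩
    fin_cases i <;> refine SF.ext_eval ?_ ?_ ?_ ?_ <;> intro t <;>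
      simp [Smooth.eval_rules, spoGen_rules]
    norm_num
  | zero => exact ⟨0, by simp⟩
  | add f g _ _ hf hg =>
    obtain ⟨y, hy⟩ := hf
    obtain ⟨z, hz⟩ := hg
    exact ⟨y + z, by rw [map_add, map_add, hy, hz, add_smul]⟩
  | smul c f _ hf =>
    obtain ⟨z, hz⟩ := hf
    exact ⟨c * z, by rw [map_smul, map_smul, hz, mul_smul]⟩

theorem spoGen_mem (i : Fin 8) : spoGen i ∈ spo :=
  Submodule.subset_span ⟨i, rfl⟩

theorem opLie_spoGen (lam mu : ℂ) (i : Fin 8) (q : Coeffs) (k : ℕ) :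
    opLie lam mu (spoGen i) (normalOp q * dx ^ k) =
      normalOp (lieTop lam mu k (spoGen i) q) * dx ^ k +
      (k : ℂ) • (normalOp (lieLow lam k (spoGen i) q) * dx ^ (k - 1)) := by
  obtain ⟨z, hz⟩ := dx_dx_eq_smul_one (spoGen_mem i)
  exact opLie_normalOp_mul_dx_pow lam mu hz q k

theorem normalOp_zero : normalOp 0 = 0 := by simp [normalOp]

/-- Generators without a lower term, those of the affine subalgebra, preserve the power of
`∂_x`. -/
theorem opLie_spoGen_affine (lam mu : ℂ) {i : Fin 8} (hi : ∀ k q, lieLow lam k (spoGen i) q = 0)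
    (q : Coeffs) (k : ℕ) :
    opLie lam mu (spoGen i) (normalOp q * dx ^ k) =
      normalOp (lieTop lam mu k (spoGen i) q) * dx ^ k := by
  rw [opLie_spoGen, hi, normalOp_zero, zero_mul, smul_zero, add_zero]

theorem opLie_affine_opLie (lam mu : ℂ) {i : Fin 8} (hi : ∀ k q, lieLow lam k (spoGen i) q = 0)
    (j : Fin 8) (q : Coeffs) (k : ℕ) :
    opLie lam mu (spoGen i) (opLie lam mu (spoGen j) (normalOp q * dx ^ k)) =
      normalOp (lieTop lam mu k (spoGen i) (lieTop lam mu k (spoGen j) q)) * dx ^ k +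
      (k : ℂ) • (normalOp (lieTop lam mu (k - 1) (spoGen i) (lieLow lam k (spoGen j) q)) *
        dx ^ (k - 1)) := by
  rw [opLie_spoGen lam mu j, opLie_add, opLie_smul, opLie_spoGen_affine lam mu hi,
    opLie_spoGen_affine lam mu hi]
  cases k with
  | zero => simp
  | succ k => simp

theorem opLie_opLie_affine (lam mu : ℂ) {j : Fin 8} (hj : ∀ k q, lieLow lam k (spoGen j) q = 0)
    (i : Fin 8) (q : Coeffs) (k : ℕ) :
    opLie lam mu (spoGen i) (opLie lam mu (spoGen j) (normalOp q * dx ^ k)) =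
      normalOp (lieTop lam mu k (spoGen i) (lieTop lam mu k (spoGen j) q)) * dx ^ k +
      (k : ℂ) • (normalOp (lieLow lam k (spoGen i) (lieTop lam mu k (spoGen j) q)) *
        dx ^ (k - 1)) := by
  rw [opLie_spoGen_affine lam mu hj, opLie_spoGen]

/-- The Casimir operator with the dual basis written out. -/
theorem casimir_eq (lam mu : ℂ) (D : Op) : casimir lam mu D =
    -(1 / 2 : ℂ) • opLie lam mu (spoGen 7) (opLie lam mu (spoGen 0) D) -
      opLie lam mu (spoGen 5) (opLie lam mu (spoGen 1) D) -
      opLie lam mu (spoGen 6) (opLie lam mu (spoGen 2) D) +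
      opLie lam mu (spoGen 3) (opLie lam mu (spoGen 3) D) +
      opLie lam mu (spoGen 4) (opLie lam mu (spoGen 4) D) +
      opLie lam mu (spoGen 1) (opLie lam mu (spoGen 5) D) +
      opLie lam mu (spoGen 2) (opLie lam mu (spoGen 6) D) -
      (1 / 2 : ℂ) • opLie lam mu (spoGen 0) (opLie lam mu (spoGen 7) D) := by
  have hneg (f : SF) (E : Op) : opLie lam mu (-f) E = -opLie lam mu f E := by
    rw [← neg_one_smul ℂ, opLie_smul_left, neg_one_smul]
  simp only [casimir, Fin.sum_univ_eight, spoDual_rules, hneg, opLie_smul_left]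
  module

/-- The Casimir operator lowers the power of `∂_x` by at most one: in each of its eight products
one factor belongs to the affine subalgebra. -/
theorem casimir_normalOp_mul_dx_pow (lam mu : ℂ) (q : Coeffs) (k : ℕ) :
    casimir lam mu (normalOp q * dx ^ k) = normalOp (casimirTop lam mu k q) * dx ^ k +
      (k : ℂ) • (normalOp (casimirLow lam k q) * dx ^ (k - 1)) := by
  have h0 (k q) : lieLow lam k (spoGen 0) q = 0 := (lieLow_spoGen lam k q).1
  have h1 (k q) : lieLow lam k (spoGen 1) q = 0 := (lieLow_spoGen lam k q).2.1
  have h2 (k q) : lieLow lam k (spoGen 2) q = 0 := (lieLow_spoGen lam k q).2.2.1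
  have h3 (k q) : lieLow lam k (spoGen 3) q = 0 := (lieLow_spoGen lam k q).2.2.2.1
  have h4 (k q) : lieLow lam k (spoGen 4) q = 0 := (lieLow_spoGen lam k q).2.2.2.2.1
  rw [casimir_eq, opLie_opLie_affine lam mu h0, opLie_opLie_affine lam mu h1,
    opLie_opLie_affine lam mu h2, opLie_spoGen_affine lam mu h3, opLie_spoGen_affine lam mu h3,
    opLie_spoGen_affine lam mu h4, opLie_spoGen_affine lam mu h4, opLie_affine_opLie lam mu h1,
    opLie_affine_opLie lam mu h2, opLie_affine_opLie lam mu h0, casimirTop_eq,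
    casimirLow_eq lam mu]
  simp only [normalOp_add, normalOp_sub, normalOp_smul, add_mul, sub_mul, smul_mul_assoc]
  module

theorem casimir_add (lam mu : ℂ) (D E : Op) :
    casimir lam mu (D + E) = casimir lam mu D + casimir lam mu E := by
  simp only [casimir, opLie_add, Finset.sum_add_distrib]

theorem casimir_smul (lam mu z : ℂ) (D : Op) :
    casimir lam mu (z • D) = z • casimir lam mu D := by
  simp only [casimir, opLie_smul, Finset.smul_sum]

/-- The Casimir operator as a linear map. -/
def casimirMap (lam mu : ℂ) : Op →ₗ[ℂ] Op where
  toFun := casimir lam mu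
  map_add' := casimir_add lam mu
  map_smul' := casimir_smul lam mu

/-! ### The Casimir operator on affine symbols -/

theorem qAffPair_even (j : ℕ) (F : SF × SF) : qAffPair (2 * (j + 1)) F =
    normalOp (F.1, 0, 0, 0) * dx ^ (j + 1) + normalOp (0, 0, 0, F.2) * dx ^ j := by
  have h : 2 * (j + 1) / 2 = j + 1 := by omega
  have hc : dx ^ j * Dbar₁ * Dbar₂ = Dbar₁ * Dbar₂ * dx ^ j := by
    rw [(commute_dx_Dbar₁.pow_left j).eq, mul_assoc, (commute_dx_Dbar₂.pow_left j).eq, mul_assoc]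
  simp [qAffPair, normalOp, h, hc, mul_assoc]

theorem qAffPair_zero {F : SF × SF} (hF : F.2 = 0) :
    qAffPair 0 F = normalOp (F.1, 0, 0, 0) := by
  simp [qAffPair, normalOp, hF]

theorem qAffPair_odd (j : ℕ) (F : SF × SF) : qAffPair (2 * j + 1) F =
    normalOp (0, F.1, F.2, 0) * dx ^ j := by
  have h : (2 * j + 1) / 2 = j := by omega
  have ho : ¬ Even (2 * j + 1) := by simp
  simp [qAffPair, normalOp, h, ho, add_mul, mul_assoc, (commute_dx_Dbar₁.pow_left j).eq,
    (commute_dx_Dbar₂.pow_left j).eq]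

/-- The part of the Casimir operator that maps symbols of integer degree `k` to symbols of degree
`k - 1/2`. -/
def halfDropEven (lam k : ℂ) : SF × SF →ₗ[ℂ] SF × SF where
  toFun F := ((1 / 2 : ℂ) • (coefA k • Dbar₁ (gradInv F.1) + coefB lam k • Dbar₂ (gradInv F.2)),
    (1 / 2 : ℂ) • (coefA k • Dbar₂ (gradInv F.1) - coefB lam k • Dbar₁ (gradInv F.2)))
  map_add' F G := by
    ext1 <;> simp only [Prod.fst_add, Prod.snd_add, map_add] <;> module
  map_smul' z F := by
    ext1 <;> simp only [Prod.smul_fst, Prod.smul_snd, map_smul, RingHom.id_apply] <;> module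

/-- The part of the Casimir operator that maps symbols of degree `k + 1/2` to symbols of integer
degree `k`. -/
def halfDropOdd (lam k : ℂ) : SF × SF →ₗ[ℂ] SF × SF where
  toFun F := ((coefB lam k / 2) • gradInv (Dbar₁ F.1 + Dbar₂ F.2),
    (coefA k / 2) • gradInv (Dbar₂ F.1 - Dbar₁ F.2))
  map_add' F G := by
    ext1 <;> simp only [Prod.fst_add, Prod.snd_add, map_add, map_sub] <;> module
  map_smul' z F := by
    ext1 <;> simp only [Prod.smul_fst, Prod.smul_snd, map_smul, map_add, map_sub,
      RingHom.id_apply] <;> module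

/-- The part of the Casimir operator that maps symbols of integer degree `k` to symbols of degree
`k - 1`. -/
def unitDropEven (lam k : ℂ) : SF × SF →ₗ[ℂ] SF × SF where
  toFun F := ((coefA k * coefB lam (k - 1)) • dx F.1, (coefA (k - 1) * coefB lam k) • dx F.2)
  map_add' F G := by
    ext1 <;> simp only [Prod.fst_add, Prod.snd_add, map_add] <;> module
  map_smul' z F := by
    ext1 <;> simp only [Prod.smul_fst, Prod.smul_snd, map_smul, RingHom.id_apply] <;> module

/-- The part of the Casimir operator that maps symbols of degree `k + 1/2` to symbols of degree
`k - 1/2`. -/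
def unitDropOdd (lam k : ℂ) : SF × SF →ₗ[ℂ] SF × SF where
  toFun F := ((coefA k * coefB lam k) • dx F.1, (coefA k * coefB lam k) • dx F.2)
  map_add' F G := by
    ext1 <;> simp only [Prod.fst_add, Prod.snd_add, map_add] <;> module
  map_smul' z F := by
    ext1 <;> simp only [Prod.smul_fst, Prod.smul_snd, map_smul, RingHom.id_apply] <;> module

theorem halfDropEven_apply (lam k : ℂ) (F : SF × SF) : halfDropEven lam k F =
    ((1 / 2 : ℂ) • (coefA k • Dbar₁ (gradInv F.1) + coefB lam k • Dbar₂ (gradInv F.2)),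
    (1 / 2 : ℂ) • (coefA k • Dbar₂ (gradInv F.1) - coefB lam k • Dbar₁ (gradInv F.2))) := rfl

theorem halfDropOdd_apply (lam k : ℂ) (F : SF × SF) : halfDropOdd lam k F =
    ((coefB lam k / 2) • gradInv (Dbar₁ F.1 + Dbar₂ F.2),
    (coefA k / 2) • gradInv (Dbar₂ F.1 - Dbar₁ F.2)) := rfl

theorem unitDropEven_apply (lam k : ℂ) (F : SF × SF) : unitDropEven lam k F =
    ((coefA k * coefB lam (k - 1)) • dx F.1, (coefA (k - 1) * coefB lam k) • dx F.2) := rfl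

theorem unitDropOdd_apply (lam k : ℂ) (F : SF × SF) : unitDropOdd lam k F =
    ((coefA k * coefB lam k) • dx F.1, (coefA k * coefB lam k) • dx F.2) := rfl

/-- `halfDropEven` or `halfDropOdd`, by the parity of the index `n` of the degree `n / 2`. -/
def halfDrop (lam : ℂ) (n : ℕ) : SF × SF →ₗ[ℂ] SF × SF :=
  if Even n then halfDropEven lam ((n / 2 : ℕ) : ℂ) else halfDropOdd lam ((n / 2 : ℕ) : ℂ)

/-- `unitDropEven` or `unitDropOdd`, by the parity of the index `n` of the degree `n / 2`. -/
def unitDrop (lam : ℂ) (n : ℕ) : SF × SF →ₗ[ℂ] SF × SF :=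
  if Even n then unitDropEven lam ((n / 2 : ℕ) : ℂ) else unitDropOdd lam ((n / 2 : ℕ) : ℂ)

theorem halfDrop_even (lam : ℂ) (k : ℕ) : halfDrop lam (2 * k) = halfDropEven lam k := by
  simp [halfDrop]

theorem halfDrop_odd (lam : ℂ) (k : ℕ) : halfDrop lam (2 * k + 1) = halfDropOdd lam k := by
  have h : (2 * k + 1) / 2 = k := by omega
  have ho : ¬ Even (2 * k + 1) := by simp
  simp only [halfDrop, h, if_neg ho]

theorem unitDrop_even (lam : ℂ) (k : ℕ) : unitDrop lam (2 * k) = unitDropEven lam k := by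
  simp [unitDrop]

theorem unitDrop_odd (lam : ℂ) (k : ℕ) : unitDrop lam (2 * k + 1) = unitDropOdd lam k := by
  have h : (2 * k + 1) / 2 = k := by omega
  have ho : ¬ Even (2 * k + 1) := by simp
  simp only [unitDrop, h, if_neg ho]

theorem alpha_even (δ : ℂ) (k : ℤ) : alpha δ (2 * k) = (δ - k) ^ 2 := by
  rw [alpha, if_pos (even_two_mul k)]
  push_cast
  ring

theorem alpha_odd (δ : ℂ) (k : ℤ) : alpha δ (2 * k + 1) = (δ - k - 1 / 2) ^ 2 - 1 / 4 := by
  rw [alpha, if_neg (by simp)]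
  push_cast
  ring

/-- For `j = 0` the truncated exponent `j - 1` is harmless: its coefficient contains
`A_j = -j = 0`. -/
theorem casimir_qAffPair_even (lam mu : ℂ) (j : ℕ) (F : SF × SF) :
    casimir lam mu (qAffPair (2 * (j + 1)) F) =
      alpha (mu - lam) (2 * (j + 1) : ℕ) • qAffPair (2 * (j + 1)) F +
      qAffPair (2 * j + 1) (halfDrop lam (2 * (j + 1)) F) +
      (normalOp ((unitDrop lam (2 * (j + 1)) F).1, 0, 0, 0) * dx ^ j +
        normalOp (0, 0, 0, (unitDrop lam (2 * (j + 1)) F).2) * dx ^ (j - 1)) := by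
  have ha := alpha_even (mu - lam) ((j + 1 : ℕ) : ℤ)
  have h1 : casimirTop lam mu (j + 1 : ℕ) (F.1, 0, 0, 0) =
      (mu - lam - (j + 1 : ℕ)) ^ 2 • ((F.1, 0, 0, 0) : Coeffs) := by
    refine coeffs_ext ?_ ?_ ?_ ?_ <;> simp [casimirTop]
  have h2 : casimirTop lam mu j (0, 0, 0, F.2) =
      (mu - lam - (j + 1 : ℕ)) ^ 2 • ((0, 0, 0, F.2) : Coeffs) +
      (0, (coefB lam (j + 1 : ℕ) / 2) • Dbar₂ (gradInv F.2),
        -(coefB lam (j + 1 : ℕ) / 2) • Dbar₁ (gradInv F.2), 0) := by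
    refine coeffs_ext ?_ ?_ ?_ ?_ <;> simp [casimirTop, coefB]
    all_goals module
  have h3 : ((j + 1 : ℕ) : ℂ) • casimirLow lam (j + 1 : ℕ) (F.1, 0, 0, 0) =
      ((unitDropEven lam (j + 1 : ℕ) F).1, (coefA (j + 1 : ℕ) / 2) • Dbar₁ (gradInv F.1),
        (coefA (j + 1 : ℕ) / 2) • Dbar₂ (gradInv F.1), 0) := by
    refine coeffs_ext ?_ ?_ ?_ ?_ <;>
      simp [casimirLow, coefA, coefB, unitDropEven_apply] <;> module
  have h4 : (j : ℂ) • casimirLow lam j (0, 0, 0, F.2) =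
      (0, 0, 0, (unitDropEven lam (j + 1 : ℕ) F).2) := by
    refine coeffs_ext ?_ ?_ ?_ ?_ <;>
      simp [casimirLow, coefA, coefB, unitDropEven_apply]
    module
  have h5 : ((0, (halfDropEven lam (j + 1 : ℕ) F).1, (halfDropEven lam (j + 1 : ℕ) F).2, 0) :
      Coeffs) = (0, (coefB lam (j + 1 : ℕ) / 2) • Dbar₂ (gradInv F.2),
        -(coefB lam (j + 1 : ℕ) / 2) • Dbar₁ (gradInv F.2), 0) +
      (0, (coefA (j + 1 : ℕ) / 2) • Dbar₁ (gradInv F.1),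
        (coefA (j + 1 : ℕ) / 2) • Dbar₂ (gradInv F.1), 0) := by
    refine coeffs_ext ?_ ?_ ?_ ?_ <;> simp [halfDropEven_apply] <;> module
  have h6 : (((unitDropEven lam (j + 1 : ℕ) F).1, (coefA (j + 1 : ℕ) / 2) • Dbar₁ (gradInv F.1),
        (coefA (j + 1 : ℕ) / 2) • Dbar₂ (gradInv F.1), 0) : Coeffs) =
      ((unitDropEven lam (j + 1 : ℕ) F).1, 0, 0, 0) +
      (0, (coefA (j + 1 : ℕ) / 2) • Dbar₁ (gradInv F.1),
        (coefA (j + 1 : ℕ) / 2) • Dbar₂ (gradInv F.1), 0) := by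
    refine coeffs_ext ?_ ?_ ?_ ?_ <;> simp
  rw [qAffPair_even, casimir_add, casimir_normalOp_mul_dx_pow, casimir_normalOp_mul_dx_pow,
    ← smul_mul_assoc, ← smul_mul_assoc, ← normalOp_smul, ← normalOp_smul, h1, h2, h3, h4, h6,
    halfDrop_even, unitDrop_even, qAffPair_odd, h5]
  push_cast at ha ⊢
  rw [ha]
  simp only [normalOp_add, normalOp_smul, add_mul, smul_mul_assoc]
  module

/-- As in `casimir_qAffPair_even`, the terms with the exponent `j - 1` vanish for `j = 0`. -/
theorem casimir_qAffPair_odd (lam mu : ℂ) (j : ℕ) (F : SF × SF) :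
    casimir lam mu (qAffPair (2 * j + 1) F) =
      alpha (mu - lam) (2 * j + 1 : ℕ) • qAffPair (2 * j + 1) F +
      (normalOp ((halfDrop lam (2 * j + 1) F).1, 0, 0, 0) * dx ^ j +
        normalOp (0, 0, 0, (halfDrop lam (2 * j + 1) F).2) * dx ^ (j - 1)) +
      normalOp (0, (unitDrop lam (2 * j + 1) F).1, (unitDrop lam (2 * j + 1) F).2, 0) *
        dx ^ (j - 1) := by
  have ha := alpha_odd (mu - lam) (j : ℤ)
  have h1 : casimirTop lam mu j (0, F.1, F.2, 0) =
      ((mu - lam - j - 1 / 2) ^ 2 - 1 / 4) • ((0, F.1, F.2, 0) : Coeffs) +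
        ((halfDropOdd lam j F).1, 0, 0, 0) := by
    refine coeffs_ext ?_ ?_ ?_ ?_ <;> simp [casimirTop, halfDropOdd_apply, coefB]
    module
  have h2 : (j : ℂ) • casimirLow lam j (0, F.1, F.2, 0) =
      (0, 0, 0, (halfDropOdd lam j F).2) +
        (0, (unitDropOdd lam j F).1, (unitDropOdd lam j F).2, 0) := by
    refine coeffs_ext ?_ ?_ ?_ ?_ <;>
      simp [casimirLow, halfDropOdd_apply, unitDropOdd_apply, coefA, coefB] <;> module
  rw [qAffPair_odd, casimir_normalOp_mul_dx_pow, ← smul_mul_assoc, ← normalOp_smul, h1, h2,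
    halfDrop_odd, unitDrop_odd]
  push_cast at ha ⊢
  rw [ha]
  simp only [normalOp_add, normalOp_smul, add_mul, smul_mul_assoc]
  module

theorem casimir_qAffPair_zero (lam mu : ℂ) {F : SF × SF} (hF : F.2 = 0) :
    casimir lam mu (qAffPair 0 F) = alpha (mu - lam) 0 • qAffPair 0 F := by
  have ha := alpha_even (mu - lam) 0
  have h1 : casimirTop lam mu 0 (F.1, 0, 0, 0) =
      (mu - lam) ^ 2 • ((F.1, 0, 0, 0) : Coeffs) := by
    refine coeffs_ext ?_ ?_ ?_ ?_ <;> simp [casimirTop]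
  have h := casimir_normalOp_mul_dx_pow lam mu (F.1, 0, 0, 0) 0
  rw [Nat.cast_zero, h1, zero_smul, add_zero, pow_zero, mul_one, mul_one, normalOp_smul] at h
  rw [qAffPair_zero hF, h]
  simp at ha
  rw [ha]

/-! ### Injectivity of the affine quantization -/

theorem D_x_pow_succ (k : ℕ) :
    Smooth.D (Smooth.x ^ (k + 1)) = ((k : ℂ) + 1) • Smooth.x ^ k := by
  induction k with
  | zero => simp
  | succ k ih =>
    refine Smooth.ext_eval fun t => ?_
    rw [pow_succ, Smooth.D_mul, ih, Smooth.D_x]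
    simp only [Smooth.eval_rules, pow_succ]
    push_cast
    ring

theorem D_pow_x_pow (k : ℕ) :
    (Smooth.D ^ k) (Smooth.x ^ k) = (k.factorial : ℂ) • (1 : Smooth) := by
  induction k with
  | zero => simp
  | succ k ih =>
    rw [pow_succ, Module.End.mul_apply, D_x_pow_succ, map_smul, ih, smul_smul, Nat.factorial_succ]
    push_cast
    rfl

theorem D_pow_x_pow_succ (k : ℕ) :
    (Smooth.D ^ k) (Smooth.x ^ (k + 1)) = ((k + 1).factorial : ℂ) • Smooth.x := by
  induction k with
  | zero => simp
  | succ k ih =>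
    rw [pow_succ, Module.End.mul_apply, D_x_pow_succ, map_smul, ih, smul_smul,
      Nat.factorial_succ (k + 1)]
    push_cast
    rfl

theorem D_pow_x_pow_of_lt {j k : ℕ} (h : k < j) : (Smooth.D ^ j) (Smooth.x ^ k) = 0 := by
  obtain ⟨i, rfl⟩ := Nat.exists_eq_add_of_lt h
  rw [show k + i + 1 = i + 1 + k by omega, pow_add, Module.End.mul_apply, D_pow_x_pow, map_smul,
    pow_succ, Module.End.mul_apply, Smooth.D_one, map_zero, smul_zero]

theorem exists_D_pow_x_pow {j k : ℕ} (h : k ≤ j) :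
    ∃ z : ℂ, (Smooth.D ^ j) (Smooth.x ^ k) = z • (1 : Smooth) := by
  rcases h.eq_or_lt with rfl | h
  · exact ⟨_, D_pow_x_pow k⟩
  · exact ⟨0, by rw [D_pow_x_pow_of_lt h, zero_smul]⟩

theorem dx_pow_mk (j : ℕ) (p q r s : Smooth) : (dx ^ j) ⟨p, q, r, s⟩ =
    ⟨(Smooth.D ^ j) p, (Smooth.D ^ j) q, (Smooth.D ^ j) r, (Smooth.D ^ j) s⟩ := by
  induction j with
  | zero => rfl
  | succ j ih =>
    rw [pow_succ', Module.End.mul_apply, ih]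
    ext1 <;> simp [pow_succ']

theorem qAff_lof (n : ℕ) (s : symbolPairs n) :
    qAff (DirectSum.lof ℂ ℕ (fun n => symbolPairs n) n s) = qAffPair n s := by
  simp [qAff]

open Classical in
theorem qAff_eq_sum (T : Symbols) : qAff T = ∑ i ∈ DFinsupp.support T, qAffPair i (T i) := by
  conv_lhs => rw [← DirectSum.sum_support_of T]
  rw [map_sum]
  exact Finset.sum_congr rfl fun i _ => qAff_lof i (T i)

theorem qAffPair_apply_of_lt {i k : ℕ} (h : 2 * k < i) (F : SF × SF) :
    qAffPair i F ⟨Smooth.x ^ k, 0, 0, 0⟩ = 0 := by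
  rcases Nat.even_or_odd' i with ⟨j, rfl | rfl⟩
  · obtain ⟨j, rfl⟩ : ∃ l, j = l + 1 := ⟨j - 1, by omega⟩
    obtain ⟨z, hz⟩ := exists_D_pow_x_pow (show k ≤ j by omega)
    have h0 := D_pow_x_pow_of_lt (show k < j + 1 by omega)
    rw [qAffPair_even]
    simp only [LinearMap.add_apply, Module.End.mul_apply, dx_pow_mk, map_zero, hz, h0]
    ext1 <;> simp [normalOp_apply, derivative_rules]
  · obtain ⟨z, hz⟩ := exists_D_pow_x_pow (show k ≤ j by omega)
    rw [qAffPair_odd]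
    simp only [Module.End.mul_apply, dx_pow_mk, map_zero, hz]
    ext1 <;> simp [normalOp_apply, derivative_rules]

theorem qAffPair_apply_θ₁_of_lt {i k : ℕ} (h : 2 * k + 1 < i) (F : SF × SF) :
    qAffPair i F ⟨0, Smooth.x ^ k, 0, 0⟩ = 0 := by
  rcases Nat.even_or_odd' i with ⟨j, rfl | rfl⟩
  · obtain ⟨j, rfl⟩ : ∃ l, j = l + 1 := ⟨j - 1, by omega⟩
    obtain ⟨z, hz⟩ := exists_D_pow_x_pow (show k ≤ j by omega)
    have h0 := D_pow_x_pow_of_lt (show k < j + 1 by omega)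
    rw [qAffPair_even]
    simp only [LinearMap.add_apply, Module.End.mul_apply, dx_pow_mk, map_zero, hz, h0]
    ext1 <;> simp [normalOp_apply, derivative_rules]
  · have h0 := D_pow_x_pow_of_lt (show k < j by omega)
    rw [qAffPair_odd]
    simp only [Module.End.mul_apply, dx_pow_mk, map_zero, h0]
    ext1 <;> simp [normalOp_apply, derivative_rules]

theorem qAffPair_apply_θ₂_of_lt {i k : ℕ} (h : 2 * k + 1 < i) (F : SF × SF) :
    qAffPair i F ⟨0, 0, Smooth.x ^ k, 0⟩ = 0 := by
  rcases Nat.even_or_odd' i with ⟨j, rfl | rfl⟩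
  · obtain ⟨j, rfl⟩ : ∃ l, j = l + 1 := ⟨j - 1, by omega⟩
    obtain ⟨z, hz⟩ := exists_D_pow_x_pow (show k ≤ j by omega)
    have h0 := D_pow_x_pow_of_lt (show k < j + 1 by omega)
    rw [qAffPair_even]
    simp only [LinearMap.add_apply, Module.End.mul_apply, dx_pow_mk, map_zero, hz, h0]
    ext1 <;> simp [normalOp_apply, derivative_rules]
  · have h0 := D_pow_x_pow_of_lt (show k < j by omega)
    rw [qAffPair_odd]
    simp only [Module.End.mul_apply, dx_pow_mk, map_zero, h0]
    ext1 <;> simp [normalOp_apply, derivative_rules]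

theorem qAffPair_apply_θ₁θ₂_of_lt {i k : ℕ} (h : 2 * (k + 1) < i) (F : SF × SF) :
    qAffPair i F ⟨0, 0, 0, Smooth.x ^ k⟩ = 0 := by
  rcases Nat.even_or_odd' i with ⟨j, rfl | rfl⟩
  · obtain ⟨j, rfl⟩ : ∃ l, j = l + 1 := ⟨j - 1, by omega⟩
    have h0 := D_pow_x_pow_of_lt (show k < j by omega)
    have h1 := D_pow_x_pow_of_lt (show k < j + 1 by omega)
    rw [qAffPair_even]
    simp only [LinearMap.add_apply, Module.End.mul_apply, dx_pow_mk, map_zero, h0, h1]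
    ext1 <;> simp [normalOp_apply, derivative_rules]
  · have h0 := D_pow_x_pow_of_lt (show k < j by omega)
    rw [qAffPair_odd]
    simp only [Module.End.mul_apply, dx_pow_mk, map_zero, h0]
    ext1 <;> simp [normalOp_apply, derivative_rules]

theorem qAffPair_apply_top (k : ℕ) {F : SF × SF} (hF : 2 * k = 0 → F.2 = 0) :
    qAffPair (2 * k) F ⟨Smooth.x ^ k, 0, 0, 0⟩ = (k.factorial : ℂ) • F.1 := by
  rcases k with _ | k
  · rw [Nat.mul_zero, qAffPair_zero (hF rfl)]
    refine SF.ext_eval ?_ ?_ ?_ ?_ <;> intro t <;>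
      simp [normalOp_apply, derivative_rules, Smooth.eval_rules]
  · rw [qAffPair_even]
    simp only [LinearMap.add_apply, Module.End.mul_apply, dx_pow_mk, map_zero, D_pow_x_pow,
      D_pow_x_pow_succ]
    refine SF.ext_eval ?_ ?_ ?_ ?_ <;> intro t <;>
      simp [normalOp_apply, derivative_rules, Smooth.eval_rules, mul_comm]

theorem qAffPair_apply_θ₁θ₂_top (k : ℕ) (F : SF × SF) :
    qAffPair (2 * (k + 1)) F ⟨0, 0, 0, Smooth.x ^ k⟩ = -(k.factorial : ℂ) • F.2 := by
  rw [qAffPair_even]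
  simp only [LinearMap.add_apply, Module.End.mul_apply, dx_pow_mk, map_zero, D_pow_x_pow,
    D_pow_x_pow_of_lt k.lt_succ_self]
  refine SF.ext_eval ?_ ?_ ?_ ?_ <;> intro t <;>
    simp [normalOp_apply, derivative_rules, Smooth.eval_rules, mul_comm]

theorem qAffPair_apply_θ₁_top (k : ℕ) (F : SF × SF) :
    qAffPair (2 * k + 1) F ⟨0, Smooth.x ^ k, 0, 0⟩ = (k.factorial : ℂ) • F.1 := by
  rw [qAffPair_odd]
  simp only [Module.End.mul_apply, dx_pow_mk, map_zero, D_pow_x_pow]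
  refine SF.ext_eval ?_ ?_ ?_ ?_ <;> intro t <;>
    simp [normalOp_apply, derivative_rules, Smooth.eval_rules]

theorem qAffPair_apply_θ₂_top (k : ℕ) (F : SF × SF) :
    qAffPair (2 * k + 1) F ⟨0, 0, Smooth.x ^ k, 0⟩ = (k.factorial : ℂ) • F.2 := by
  rw [qAffPair_odd]
  simp only [Module.End.mul_apply, dx_pow_mk, map_zero, D_pow_x_pow]
  refine SF.ext_eval ?_ ?_ ?_ ?_ <;> intro t <;>
    simp [normalOp_apply, derivative_rules, Smooth.eval_rules]

/-- The lowest nonzero component of a symbol in the kernel is recovered by applying its operator to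
the functions `x^k`, `θ₁ x^k`, `θ₂ x^k`, `θ₁ θ₂ x^k`, which the higher components annihilate. -/
theorem qAff_injective : Function.Injective qAff := by
  classical
  refine (injective_iff_map_eq_zero _).2 fun T hT => ?_
  have key (m : ℕ) (hlow : ∀ i < m, T i = 0) (g : SF)
      (hg : ∀ i, m < i → ∀ F, qAffPair i F g = 0) : qAffPair m (T m) g = 0 := by
    have h := congrArg (fun A : Op => A g) ((qAff_eq_sum T).symm.trans hT)
    simp only [LinearMap.sum_apply, LinearMap.zero_apply] at h
    rwa [Finset.sum_eq_single m] at h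
    · intro i _ hi
      rcases Nat.lt_or_gt_of_ne hi with hi | hi
      · rw [hlow i hi]
        simp
      · exact hg i hi _
    · intro hm
      rw [DFinsupp.notMem_support_iff.1 hm]
      simp
  have hne (k : ℕ) : (k.factorial : ℂ) ≠ 0 := Nat.cast_ne_zero.2 k.factorial_ne_zero
  suffices h : ∀ m, T m = 0 from DFinsupp.ext h
  intro m
  induction m using Nat.strong_induction_on with
  | _ m ih =>
    refine Subtype.ext (Prod.ext ?_ ?_)
    · rcases Nat.even_or_odd' m with ⟨k, rfl | rfl⟩
      · have h := key _ ih _ fun i hi F => qAffPair_apply_of_lt hi F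
        rw [qAffPair_apply_top k (T (2 * k)).2] at h
        exact (smul_eq_zero.1 h).resolve_left (hne k)
      · have h := key _ ih _ fun i hi F => qAffPair_apply_θ₁_of_lt hi F
        rw [qAffPair_apply_θ₁_top] at h
        exact (smul_eq_zero.1 h).resolve_left (hne k)
    · rcases Nat.even_or_odd' m with ⟨k, rfl | rfl⟩
      · rcases k with _ | k
        · exact (T (2 * 0)).2 rfl
        · have h := key _ ih _ fun i hi F => qAffPair_apply_θ₁θ₂_of_lt hi F
          rw [qAffPair_apply_θ₁θ₂_top] at h
          exact (smul_eq_zero.1 h).resolve_left (neg_ne_zero.2 (hne k))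
      · have h := key _ ih _ fun i hi F => qAffPair_apply_θ₂_of_lt hi F
        rw [qAffPair_apply_θ₂_top] at h
        exact (smul_eq_zero.1 h).resolve_left (hne k)

/-! ### The recursion for eigenvectors of the Casimir operator -/

/-- Symbols of degree zero are single superfunctions; the factor `A_0 = 0` keeps the Casimir
operator within them. -/
theorem halfDrop_mem (lam : ℂ) (n : ℕ) (F : SF × SF) : halfDrop lam (n + 1) F ∈ symbolPairs n := by
  rintro rfl
  have h := halfDrop_odd lam 0
  rw [Nat.mul_zero] at h
  simp [h, halfDropOdd_apply, coefA]

theorem unitDrop_mem (lam : ℂ) (n : ℕ) (F : SF × SF) : unitDrop lam (n + 2) F ∈ symbolPairs n := by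
  rintro rfl
  have h := unitDrop_even lam 1
  rw [Nat.mul_one] at h
  simp [h, unitDropEven_apply, coefA]

/-- The part of the Casimir operator on symbols that lowers the degree `n / 2` by `1 / 2`. -/
def halfPart (lam : ℂ) : ∀ n : ℕ, symbolPairs n →ₗ[ℂ] Symbols
  | 0 => 0
  | n + 1 => DirectSum.lof ℂ ℕ (fun n => symbolPairs n) n ∘ₗ
      ((halfDrop lam (n + 1)).comp (symbolPairs (n + 1)).subtype).codRestrict (symbolPairs n)
        fun s => halfDrop_mem lam n s

/-- The part of the Casimir operator on symbols that lowers the degree `n / 2` by `1`. -/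
def unitPart (lam : ℂ) : ∀ n : ℕ, symbolPairs n →ₗ[ℂ] Symbols
  | 0 => 0
  | 1 => 0
  | n + 2 => DirectSum.lof ℂ ℕ (fun n => symbolPairs n) n ∘ₗ
      ((unitDrop lam (n + 2)).comp (symbolPairs (n + 2)).subtype).codRestrict (symbolPairs n)
        fun s => unitDrop_mem lam n s

/-- The Casimir operator, transported to symbols by the affine quantization. -/
def symbolCasimir (lam mu : ℂ) : Symbols →ₗ[ℂ] Symbols :=
  DirectSum.toModule ℂ ℕ Symbols fun n =>
    alpha (mu - lam) n • DirectSum.lof ℂ ℕ (fun n => symbolPairs n) n +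
      halfPart lam n + unitPart lam n

theorem symbolCasimir_lof (lam mu : ℂ) (n : ℕ) (s : symbolPairs n) :
    symbolCasimir lam mu (DirectSum.lof ℂ ℕ (fun n => symbolPairs n) n s) =
      alpha (mu - lam) n • DirectSum.lof ℂ ℕ (fun n => symbolPairs n) n s +
      halfPart lam n s + unitPart lam n s := by
  simp [symbolCasimir]

theorem qAff_halfPart (lam : ℂ) (n : ℕ) (s : symbolPairs (n + 1)) :
    qAff (halfPart lam (n + 1) s) = qAffPair n (halfDrop lam (n + 1) s) := by
  rw [halfPart, LinearMap.comp_apply, qAff_lof]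
  rfl

theorem qAff_unitPart (lam : ℂ) (n : ℕ) (s : symbolPairs (n + 2)) :
    qAff (unitPart lam (n + 2) s) = qAffPair n (unitDrop lam (n + 2) s) := by
  rw [unitPart, LinearMap.comp_apply, qAff_lof]
  rfl

theorem casimir_qAffPair_one (lam mu : ℂ) (F : SF × SF) :
    casimir lam mu (qAffPair 1 F) =
      alpha (mu - lam) (1 : ℕ) • qAffPair 1 F + qAffPair 0 (halfDrop lam 1 F) := by
  have e := casimir_qAffPair_odd lam mu 0 F
  have h := halfDrop_mem lam 0 F rfl
  have h' : unitDrop lam (2 * 0 + 1) F = 0 := by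
    rw [unitDrop_odd]
    simp [unitDropOdd_apply, coefA]
  rw [h'] at e
  simp only [Nat.mul_zero, Nat.zero_add] at e h
  have z : normalOp (0, 0, 0, 0) = 0 := normalOp_zero
  rw [qAffPair_zero h, e, h, Prod.fst_zero, Prod.snd_zero, z, zero_mul, add_zero,
    add_zero, pow_zero, mul_one]

theorem casimir_qAffPair_add_two (lam mu : ℂ) (n : ℕ) (F : SF × SF) :
    casimir lam mu (qAffPair (n + 2) F) =
      alpha (mu - lam) (n + 2 : ℕ) • qAffPair (n + 2) F +
        qAffPair (n + 1) (halfDrop lam (n + 2) F) + qAffPair n (unitDrop lam (n + 2) F) := by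
  rcases Nat.even_or_odd' n with ⟨j, rfl | rfl⟩
  · have e := casimir_qAffPair_even lam mu j F
    rw [show 2 * (j + 1) = 2 * j + 2 by ring] at e
    rw [e]
    congr 1
    rcases j with _ | j
    · have h := unitDrop_mem lam 0 F rfl
      have z : normalOp (0, 0, 0, 0) = 0 := normalOp_zero
      simp only [Nat.mul_zero, Nat.zero_add] at h ⊢
      rw [qAffPair_zero h, h, z, zero_mul, add_zero, pow_zero, mul_one]
    · rw [qAffPair_even, Nat.add_sub_cancel]
  · have e := casimir_qAffPair_odd lam mu (j + 1) F
    rw [show 2 * (j + 1) + 1 = 2 * j + 1 + 2 by ring] at e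
    rw [e, show 2 * j + 1 + 1 = 2 * (j + 1) by ring, qAffPair_even, qAffPair_odd,
      Nat.add_sub_cancel]

theorem casimir_qAffPair (lam mu : ℂ) (n : ℕ) (s : symbolPairs n) :
    casimir lam mu (qAffPair n s) =
      qAff (symbolCasimir lam mu (DirectSum.lof ℂ ℕ (fun n => symbolPairs n) n s)) := by
  rw [symbolCasimir_lof, map_add, map_add, map_smul, qAff_lof]
  match n, s with
  | 0, s =>
    rw [casimir_qAffPair_zero _ _ (s.2 rfl)]
    simp [halfPart, unitPart]
  | 1, s =>
    rw [casimir_qAffPair_one, qAff_halfPart, unitPart, LinearMap.zero_apply, map_zero, add_zero]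
  | n + 2, s =>
    rw [casimir_qAffPair_add_two, qAff_halfPart, qAff_unitPart]

theorem casimir_qAff (lam mu : ℂ) (T : Symbols) :
    casimir lam mu (qAff T) = qAff (symbolCasimir lam mu T) := by
  have h : (casimirMap lam mu).comp qAff = qAff.comp (symbolCasimir lam mu) := by
    refine DirectSum.linearMap_ext ℂ fun n => LinearMap.ext fun s => ?_
    simp only [LinearMap.comp_apply, qAff_lof]
    exact casimir_qAffPair lam mu n s
  exact LinearMap.congr_fun h T

/-- The component of degree `m / 2` of the Casimir operator receives contributions from the three
degrees `m / 2`, `(m + 1) / 2` and `(m + 2) / 2`. -/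
theorem symbolCasimir_apply (lam mu : ℂ) (T : Symbols) (m : ℕ) :
    (symbolCasimir lam mu T m : SF × SF) = alpha (mu - lam) m • (T m : SF × SF) +
      halfDrop lam (m + 1) (T (m + 1)) + unitDrop lam (m + 2) (T (m + 2)) := by
  have h : (symbolPairs m).subtype ∘ₗ DirectSum.component ℂ ℕ (fun n => symbolPairs n) m ∘ₗ
      symbolCasimir lam mu =
      alpha (mu - lam) m • ((symbolPairs m).subtype ∘ₗ
        DirectSum.component ℂ ℕ (fun n => symbolPairs n) m) +
      halfDrop lam (m + 1) ∘ₗ (symbolPairs (m + 1)).subtype ∘ₗ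
        DirectSum.component ℂ ℕ (fun n => symbolPairs n) (m + 1) +
      unitDrop lam (m + 2) ∘ₗ (symbolPairs (m + 2)).subtype ∘ₗ
        DirectSum.component ℂ ℕ (fun n => symbolPairs n) (m + 2) := by
    refine DirectSum.linearMap_ext ℂ fun n => LinearMap.ext fun s => ?_
    have hlof {i j : ℕ} (hij : i ≠ j) (t : symbolPairs i) :
        DirectSum.component ℂ ℕ (fun n => symbolPairs n) j
          (DirectSum.lof ℂ ℕ (fun n => symbolPairs n) i t) = 0 :=
      DirectSum.of_eq_of_ne _ _ _ (Ne.symm hij)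
    have hself {i : ℕ} (t : symbolPairs i) :
        DirectSum.component ℂ ℕ (fun n => symbolPairs n) i
          (DirectSum.lof ℂ ℕ (fun n => symbolPairs n) i t) = t :=
      DirectSum.of_eq_same _ _
    simp only [LinearMap.comp_apply, LinearMap.add_apply, LinearMap.smul_apply,
      symbolCasimir_lof, map_add, map_smul]
    have hhalf : DirectSum.component ℂ ℕ (fun n => symbolPairs n) m (halfPart lam n s) =
        if h : n = m + 1 then ⟨halfDrop lam (m + 1) (h ▸ s : symbolPairs (m + 1)),
          halfDrop_mem lam m _⟩ else 0 := by
      split_ifs with h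
      · subst h
        exact hself _
      · rcases n with _ | n
        · simp [halfPart]
        · exact hlof (by omega) _
    have hunit : DirectSum.component ℂ ℕ (fun n => symbolPairs n) m (unitPart lam n s) =
        if h : n = m + 2 then ⟨unitDrop lam (m + 2) (h ▸ s : symbolPairs (m + 2)),
          unitDrop_mem lam m _⟩ else 0 := by
      split_ifs with h
      · subst h
        exact hself _
      · rcases n with _ | _ | n
        · simp [unitPart]
        · simp [unitPart]
        · exact hlof (by omega) _
    rw [hhalf, hunit]
    by_cases h0 : n = m
    · subst h0
      rw [hself, hlof (by omega), hlof (by omega)]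
      simp
    by_cases h1 : n = m + 1
    · subst h1
      rw [hself, hlof (by omega), hlof (by omega)]
      simp
    by_cases h2 : n = m + 2
    · subst h2
      rw [hself, hlof (by omega), hlof (by omega)]
      simp
    rw [hlof h0, hlof h1, hlof h2]
    simp [h1, h2]
  exact LinearMap.congr_fun h T

/-- A symbol lifts the eigenvalue equation if and only if its components satisfy a two-step
recursion. -/
theorem casimir_eq_smul_iff (lam mu z : ℂ) (T : Symbols) :
    casimir lam mu (qAff T) = z • qAff T ↔ ∀ m : ℕ, (z - alpha (mu - lam) m) • (T m : SF × SF) =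
      halfDrop lam (m + 1) (T (m + 1)) + unitDrop lam (m + 2) (T (m + 2)) := by
  rw [casimir_qAff, ← map_smul, qAff_injective.eq_iff]
  constructor
  · intro h m
    have := symbolCasimir_apply lam mu T m
    rw [h] at this
    change z • (T m : SF × SF) = _ at this
    rw [sub_smul, this]
    abel
  · intro h
    refine DFinsupp.ext fun m => Subtype.ext ?_
    rw [symbolCasimir_apply, add_assoc, ← h m]
    change _ = z • (T m : SF × SF)
    rw [sub_smul]
    abel

theorem alpha_sub_ne_zero {δ : ℂ} (hδ : ¬ IsCritical δ) {m n : ℕ} (h : m < n) :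
    alpha δ n - alpha δ m ≠ 0 := fun h0 => hδ ⟨m, n, h, sub_eq_zero.1 h0⟩

/-- Away from critical values the recursion determines each component from the two above it. -/
theorem IsCasimirLift.unique {lam mu : ℂ} (hδ : ¬ IsCritical (mu - lam)) {n : ℕ}
    {S : symbolPairs n} {T U : Symbols} (hT : IsCasimirLift lam mu n S T)
    (hU : IsCasimirLift lam mu n S U) : T = U := by
  have eT := (casimir_eq_smul_iff _ _ _ _).1 hT.eigen
  have eU := (casimir_eq_smul_iff _ _ _ _).1 hU.eigen
  have key (d : ℕ) : ∀ m, n ≤ m + d → T m = U m := by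
    induction d with
    | zero =>
      intro m hm
      rcases (show n ≤ m from hm).eq_or_lt with rfl | hm
      · rw [hT.top, hU.top]
      · rw [hT.above m hm, hU.above m hm]
    | succ d ih =>
      intro m hm
      rcases Nat.lt_or_ge m n with hmn | hmn
      · have h := eT m
        rw [ih (m + 1) (by omega), ih (m + 2) (by omega), ← eU m] at h
        exact Subtype.ext (smul_right_injective _ (alpha_sub_ne_zero hδ hmn) h)
      · exact ih m (by omega)
  exact DFinsupp.ext fun m => key n m (by omega)

/-! ### The explicit lift -/

theorem matC_act (lam : ℂ) (k l : ℕ) (F : SF × SF) : matAct (matC lam k l) F =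
    ((coefA k * coefB lam ((k : ℂ) - l)) • (dx ^ l) F.1,
      (coefA ((k : ℂ) - l) * coefB lam k) • (dx ^ l) F.2) := by
  simp [matAct, matC]

theorem matD_act (lam : ℂ) (k l : ℕ) (F : SF × SF) : matAct (matD lam k l) F =
    ((coefA k * coefB lam ((k : ℂ) - l)) • (dx ^ l) F.1 -
        (coefB lam k * coefB lam ((k : ℂ) - l)) • Dbar₁ (Dbar₂ ((dx ^ (l - 1)) F.2)),
      (coefA k * coefA ((k : ℂ) - l)) • Dbar₁ (Dbar₂ ((dx ^ (l - 1)) F.1)) +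
        (coefA ((k : ℂ) - l) * coefB lam k) • (dx ^ l) F.2) := by
  simp [matAct, matD, sub_eq_add_neg]

theorem matE_act (lam : ℂ) (k j : ℕ) (F : SF × SF) : matAct (matE lam k j) F =
    (coefA k • Dbar₁ ((dx ^ j) F.1) + coefB lam k • Dbar₂ ((dx ^ j) F.2),
      coefA k • Dbar₂ ((dx ^ j) F.1) - coefB lam k • Dbar₁ ((dx ^ j) F.2)) := by
  simp [matAct, matE, sub_eq_add_neg]

/-- The grading involution on pairs. -/
def gradPair (F : SF × SF) : SF × SF := (gradInv F.1, gradInv F.2)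

theorem dx_pow_gradInv (j : ℕ) (f : SF) : (dx ^ j) (gradInv f) = gradInv ((dx ^ j) f) :=
  LinearMap.congr_fun (commute_dx_gradInv.pow_left j).eq f

theorem dx_pow_succ_apply (j : ℕ) (f : SF) : (dx ^ (j + 1)) f = dx ((dx ^ j) f) := by
  rw [pow_succ', Module.End.mul_apply]

theorem halfDropOdd_matE (lam : ℂ) (k j : ℕ) (F : SF × SF) :
    halfDropOdd lam ((k : ℂ) - (j + 1 : ℕ)) (matAct (matE lam k j) (gradPair F)) =
      -matAct (matD lam k (j + 1)) F := by
  rw [matE_act, matD_act, halfDropOdd_apply, Nat.add_sub_cancel]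
  simp only [gradPair, dx_pow_gradInv, dx_pow_succ_apply]
  refine Prod.ext ?_ ?_ <;> refine SF.ext_eval ?_ ?_ ?_ ?_ <;> intro t <;>
    simp only [Prod.fst_neg, Prod.snd_neg, component_rules, derivative_rules, Smooth.eval_rules] <;>
    ring

theorem halfDropEven_self (lam : ℂ) (k : ℕ) (F : SF × SF) :
    halfDropEven lam k F = (1 / 2 : ℂ) • matAct (matE lam k 0) (gradPair F) := by
  rw [matE_act, halfDropEven_apply]
  rfl

theorem halfDropEven_matC (lam : ℂ) (k j : ℕ) (F : SF × SF) :
    halfDropEven lam ((k : ℂ) - j) (matAct (matC lam k j) F) =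
      (1 / 2 * (coefA ((k : ℂ) - j) * coefB lam ((k : ℂ) - j))) •
        matAct (matE lam k j) (gradPair F) := by
  rw [matE_act, matC_act, halfDropEven_apply]
  simp only [gradPair, dx_pow_gradInv]
  refine Prod.ext ?_ ?_ <;> simp only [Prod.smul_fst, Prod.smul_snd, map_smul] <;> module

theorem halfDropEven_matD (lam : ℂ) (k j : ℕ) (F : SF × SF) :
    halfDropEven lam ((k : ℂ) - (j + 1 : ℕ)) (matAct (matD lam k (j + 1)) F) =
      (coefA ((k : ℂ) - (j + 1 : ℕ)) * coefB lam ((k : ℂ) - (j + 1 : ℕ))) •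
        matAct (matE lam k (j + 1)) (gradPair F) := by
  rw [matE_act, matD_act, halfDropEven_apply, Nat.add_sub_cancel]
  simp only [gradPair, dx_pow_gradInv, dx_pow_succ_apply]
  refine Prod.ext ?_ ?_ <;> refine SF.ext_eval ?_ ?_ ?_ ?_ <;> intro t <;>
    simp only [Prod.smul_fst, Prod.smul_snd, component_rules, derivative_rules,
      Smooth.eval_rules] <;>
    ring

theorem unitDropEven_self (lam : ℂ) (k : ℕ) (F : SF × SF) :
    unitDropEven lam k F = matAct (matC lam k 1) F := by
  rw [matC_act, unitDropEven_apply, pow_one, Nat.cast_one]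

theorem unitDropEven_matC (lam : ℂ) (k l : ℕ) (F : SF × SF) :
    unitDropEven lam ((k : ℂ) - l) (matAct (matC lam k l) F) =
      (coefA ((k : ℂ) - l) * coefB lam ((k : ℂ) - l)) • matAct (matC lam k (l + 1)) F := by
  rw [matC_act, matC_act, unitDropEven_apply]
  simp only [dx_pow_succ_apply, Nat.cast_succ, sub_sub]
  refine Prod.ext ?_ ?_ <;> simp only [Prod.smul_fst, Prod.smul_snd, map_smul] <;> module

theorem unitDropEven_matD (lam : ℂ) (k l : ℕ) (F : SF × SF) :
    unitDropEven lam ((k : ℂ) - (l + 1 : ℕ)) (matAct (matD lam k (l + 1)) F) =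
      (coefA ((k : ℂ) - (l + 1 : ℕ)) * coefB lam ((k : ℂ) - (l + 1 : ℕ))) •
        matAct (matD lam k (l + 2)) F := by
  have e : ((k : ℂ) - (l + 2 : ℕ)) = k - (l + 1 : ℕ) - 1 := by push_cast; ring
  rw [matD_act, matD_act, unitDropEven_apply, Nat.add_sub_cancel, e,
    show l + 2 - 1 = l + 1 by omega]
  simp only [dx_pow_succ_apply]
  refine Prod.ext ?_ ?_ <;> refine SF.ext_eval ?_ ?_ ?_ ?_ <;> intro t <;>
    simp only [Prod.smul_fst, Prod.smul_snd, component_rules, derivative_rules,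
      Smooth.eval_rules] <;>
    ring

theorem unitDropOdd_matE (lam : ℂ) (k j : ℕ) (z : ℂ) (F : SF × SF) :
    unitDropOdd lam z (matAct (matE lam k j) F) =
      (coefA z * coefB lam z) • matAct (matE lam k (j + 1)) F := by
  rw [matE_act, matE_act, unitDropOdd_apply]
  simp only [dx_pow_succ_apply]
  refine Prod.ext ?_ ?_ <;> refine SF.ext_eval ?_ ?_ ?_ ?_ <;> intro t <;>
    simp only [Prod.smul_fst, Prod.smul_snd, component_rules, derivative_rules,
      Smooth.eval_rules]

/-- The lower components of the lift; `i` is twice the difference of the degrees. For a pair of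
parity `p`, the sign `(-1)^p` is the action of `gradPair`, which makes sense for all pairs. -/
def liftPair (lam mu : ℂ) (k : ℕ) (F : SF × SF) (i : ℕ) : SF × SF :=
  if i = 0 then F
  else if Even i then coefC lam mu k (i / 2) • matAct (matC lam k (i / 2)) F +
    coefD lam mu k (i / 2) • matAct (matD lam k (i / 2)) F
  else coefE lam mu k (i / 2) • matAct (matE lam k (i / 2)) (gradPair F)

theorem liftPair_zero (lam mu : ℂ) (k : ℕ) (F : SF × SF) : liftPair lam mu k F 0 = F := rfl

theorem liftPair_even (lam mu : ℂ) (k : ℕ) (F : SF × SF) (l : ℕ) :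
    liftPair lam mu k F (2 * (l + 1)) = coefC lam mu k (l + 1) • matAct (matC lam k (l + 1)) F +
      coefD lam mu k (l + 1) • matAct (matD lam k (l + 1)) F := by
  have h : 2 * (l + 1) / 2 = l + 1 := by omega
  rw [liftPair, if_neg (by omega), if_pos (even_two_mul _), h]

theorem liftPair_odd (lam mu : ℂ) (k : ℕ) (F : SF × SF) (j : ℕ) :
    liftPair lam mu k F (2 * j + 1) =
      coefE lam mu k j • matAct (matE lam k j) (gradPair F) := by
  have h : (2 * j + 1) / 2 = j := by omega
  rw [liftPair, if_neg (by omega), if_neg (by simp), h]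

/-- The product `A_(k-i) B_(k-i) / (α_k - α_(k-i))` over `1 ≤ i ≤ l`. -/
def coefRatio (lam mu : ℂ) (k l : ℕ) : ℂ :=
  (∏ i ∈ Finset.Icc 1 l, coefA ((k : ℂ) - i) * coefB lam ((k : ℂ) - i)) /
    ∏ i ∈ Finset.Icc 1 l, (alpha (mu - lam) (2 * k) - alpha (mu - lam) (2 * k - 2 * i))

theorem coefRatio_zero (lam mu : ℂ) (k : ℕ) : coefRatio lam mu k 0 = 1 := by
  simp [coefRatio]

theorem coefRatio_succ (lam mu : ℂ) (k l : ℕ) : coefRatio lam mu k (l + 1) =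
    coefRatio lam mu k l * (coefA ((k : ℂ) - (l + 1 : ℕ)) * coefB lam ((k : ℂ) - (l + 1 : ℕ))) /
      (alpha (mu - lam) (2 * k) - alpha (mu - lam) (2 * k - 2 * (l + 1 : ℕ))) := by
  rw [coefRatio, coefRatio, Finset.prod_Icc_succ_top (by omega),
    Finset.prod_Icc_succ_top (by omega), div_mul_eq_mul_div, div_div]

theorem coefC_succ (lam mu : ℂ) (k l : ℕ) : coefC lam mu k (l + 1) = coefRatio lam mu k l /
    (alpha (mu - lam) (2 * k) - alpha (mu - lam) (2 * k - 2 * (l + 1 : ℕ))) := by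
  rw [coefC, coefRatio, Finset.prod_Icc_succ_top (by omega), Nat.add_sub_cancel, div_div]

theorem coefD_succ (lam mu : ℂ) (k l : ℕ) : coefD lam mu k (l + 1) =
    -((l : ℂ) + 1) * coefRatio lam mu k l /
      (2 * (alpha (mu - lam) (2 * k) - alpha (mu - lam) (2 * k - 1)) *
        (alpha (mu - lam) (2 * k) - alpha (mu - lam) (2 * k - 2 * (l + 1 : ℕ)))) := by
  rw [coefD, coefRatio, Finset.prod_Icc_succ_top (by omega), Nat.add_sub_cancel, mul_div_assoc,
    mul_div_assoc, div_mul_eq_div_div_swap, div_mul_eq_div_div_swap, div_div, div_div, div_div]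
  push_cast
  ring_nf

theorem coefE_eq (lam mu : ℂ) (k j : ℕ) : coefE lam mu k j = coefRatio lam mu k j /
    (2 * (alpha (mu - lam) (2 * k) - alpha (mu - lam) (2 * k - 1))) := by
  rw [coefE, coefRatio, div_div, mul_comm (2 * _)]

theorem alpha_sub_even (δ : ℂ) (k : ℤ) (l : ℕ) :
    alpha δ (2 * k) - alpha δ (2 * k - 2 * l) = l * (2 * (k - δ) - l) := by
  rw [← mul_sub, alpha_even, alpha_even]
  push_cast
  ring

/-- Together with `alpha_sub_even` this says that the difference at the half step `j + 1/2` is the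
one at `j` plus the one at `1/2` minus `j`, which is what makes the half-step recursion close. -/
theorem alpha_sub_odd (δ : ℂ) (k : ℤ) (j : ℕ) :
    alpha δ (2 * k) - alpha δ (2 * k - (2 * j + 1)) = k - δ - j + j * (2 * (k - δ) - j) := by
  rw [show 2 * k - (2 * j + 1) = 2 * (k - j - 1) + 1 by ring, alpha_even, alpha_odd]
  push_cast
  ring

/-- The recursion at the first half step. -/
theorem liftPair_rec_one {lam mu : ℂ} {k : ℕ} (F : SF × SF)
    (h : alpha (mu - lam) (2 * k) - alpha (mu - lam) (2 * k - 1) ≠ 0) :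
    (alpha (mu - lam) (2 * k) - alpha (mu - lam) (2 * k - 1)) • liftPair lam mu k F 1 =
      halfDropEven lam k F := by
  rw [← Nat.zero_add 1, ← Nat.mul_zero 2, liftPair_odd, halfDropEven_self, coefE_eq,
    coefRatio_zero, smul_smul]
  congr 1
  field_simp

/-- The recursion at the first integer step. -/
theorem liftPair_rec_two {lam mu : ℂ} {k : ℕ} (F : SF × SF)
    (h₁ : alpha (mu - lam) (2 * k) - alpha (mu - lam) (2 * k - 1) ≠ 0)
    (h₂ : alpha (mu - lam) (2 * k) - alpha (mu - lam) (2 * k - 2 * (1 : ℕ)) ≠ 0) :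
    (alpha (mu - lam) (2 * k) - alpha (mu - lam) (2 * k - 2 * (1 : ℕ))) • liftPair lam mu k F 2 =
      halfDropOdd lam ((k : ℂ) - 1) (liftPair lam mu k F 1) + unitDropEven lam k F := by
  have e := halfDropOdd_matE lam k 0 F
  rw [Nat.zero_add, Nat.cast_one] at e
  have hl := liftPair_even lam mu k F 0
  have ho := liftPair_odd lam mu k F 0
  simp only [Nat.zero_add, Nat.mul_one, Nat.mul_zero] at hl ho
  have hC := coefC_succ lam mu k 0
  have hD := coefD_succ lam mu k 0
  rw [Nat.zero_add] at hC hD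
  rw [hl, ho, map_smul, e, unitDropEven_self, hC, hD, coefE_eq, coefRatio_zero, smul_add,
    smul_smul, smul_smul, smul_neg, ← neg_smul, add_comm]
  congr 2
  · rw [Nat.cast_zero, zero_add]
    field_simp
  · rw [mul_one_div_cancel h₂, one_smul]

/-- The recursion at the later integer steps. -/
theorem liftPair_rec_even {lam mu : ℂ} {k l : ℕ} (F : SF × SF)
    (h₁ : alpha (mu - lam) (2 * k) - alpha (mu - lam) (2 * k - 1) ≠ 0)
    (h₂ : alpha (mu - lam) (2 * k) - alpha (mu - lam) (2 * k - 2 * (l + 1 : ℕ)) ≠ 0)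
    (h₃ : alpha (mu - lam) (2 * k) - alpha (mu - lam) (2 * k - 2 * (l + 2 : ℕ)) ≠ 0) :
    (alpha (mu - lam) (2 * k) - alpha (mu - lam) (2 * k - 2 * (l + 2 : ℕ))) •
        liftPair lam mu k F (2 * (l + 2)) =
      halfDropOdd lam ((k : ℂ) - (l + 2 : ℕ)) (liftPair lam mu k F (2 * (l + 1) + 1)) +
        unitDropEven lam ((k : ℂ) - (l + 1 : ℕ)) (liftPair lam mu k F (2 * (l + 1))) := by
  rw [liftPair_even lam mu k F (l + 1), liftPair_even lam mu k F l, liftPair_odd, map_smul,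
    halfDropOdd_matE lam k (l + 1), map_add, map_smul, map_smul, unitDropEven_matC,
    unitDropEven_matD, coefC_succ, coefC_succ, coefD_succ, coefD_succ, coefE_eq, coefRatio_succ]
  set X := matAct (matC lam k (l + 1 + 1)) F
  set Y := matAct (matD lam k (l + 1 + 1)) F
  set r := coefRatio lam mu k l
  set ab := coefA ((k : ℂ) - (l + 1 : ℕ)) * coefB lam ((k : ℂ) - (l + 1 : ℕ))
  set Δ := alpha (mu - lam) (2 * k) - alpha (mu - lam) (2 * k - 1)
  set Δ₁ := alpha (mu - lam) (2 * k) - alpha (mu - lam) (2 * k - 2 * (l + 1 : ℕ))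
  set Δ₂ := alpha (mu - lam) (2 * k) - alpha (mu - lam) (2 * k - 2 * (l + 2 : ℕ))
  have e₁ : Δ₂ * (r * ab / Δ₁ / Δ₂) = r / Δ₁ * ab := by field_simp
  have e₂ : Δ₂ * (-((l + 1 : ℕ) + 1 : ℂ) * (r * ab / Δ₁) / (2 * Δ * Δ₂)) =
      -(r * ab / Δ₁ / (2 * Δ)) + -((l : ℂ) + 1) * r / (2 * Δ * Δ₁) * ab := by
    push_cast
    field_simp
    ring
  rw [smul_add, smul_smul, smul_smul, smul_smul, smul_smul, e₁, e₂]
  module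

/-- The recursion at the later half steps. -/
theorem liftPair_rec_odd {lam mu : ℂ} {k j : ℕ} (F : SF × SF)
    (h₁ : alpha (mu - lam) (2 * k) - alpha (mu - lam) (2 * k - 1) ≠ 0)
    (h₂ : alpha (mu - lam) (2 * k) - alpha (mu - lam) (2 * k - 2 * (j + 1 : ℕ)) ≠ 0) :
    (alpha (mu - lam) (2 * k) - alpha (mu - lam) (2 * k - (2 * (j + 1 : ℕ) + 1))) •
        liftPair lam mu k F (2 * (j + 1) + 1) =
      halfDropEven lam ((k : ℂ) - (j + 1 : ℕ)) (liftPair lam mu k F (2 * (j + 1))) +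
        unitDropOdd lam ((k : ℂ) - (j + 1 : ℕ)) (liftPair lam mu k F (2 * j + 1)) := by
  have e₁ := alpha_sub_odd (mu - lam) k (j + 1)
  have e₂ := alpha_sub_even (mu - lam) k (j + 1)
  have e₃ : alpha (mu - lam) (2 * k) - alpha (mu - lam) (2 * k - 1) = k - (mu - lam) := by
    simpa using alpha_sub_odd (mu - lam) k 0
  rw [liftPair_even, liftPair_odd, liftPair_odd, map_add, map_smul, map_smul, map_smul,
    halfDropEven_matC, halfDropEven_matD, unitDropOdd_matE, coefC_succ, coefD_succ, coefE_eq,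
    coefE_eq, coefRatio_succ]
  have e₄ : alpha (mu - lam) (2 * k) - alpha (mu - lam) (2 * k - (2 * (j + 1 : ℕ) + 1)) =
      (alpha (mu - lam) (2 * k) - alpha (mu - lam) (2 * k - 1)) - ((j : ℂ) + 1) +
        (alpha (mu - lam) (2 * k) - alpha (mu - lam) (2 * k - 2 * (j + 1 : ℕ))) := by
    rw [e₁, e₂, e₃]
    push_cast
    ring
  rw [e₄]
  set X := matAct (matE lam k (j + 1)) (gradPair F)
  set r := coefRatio lam mu k j
  set ab := coefA ((k : ℂ) - (j + 1 : ℕ)) * coefB lam ((k : ℂ) - (j + 1 : ℕ))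
  set Δ := alpha (mu - lam) (2 * k) - alpha (mu - lam) (2 * k - 1)
  set Δ₁ := alpha (mu - lam) (2 * k) - alpha (mu - lam) (2 * k - 2 * (j + 1 : ℕ))
  rw [smul_smul, smul_smul, smul_smul, smul_smul, ← add_smul, ← add_smul]
  congr 1
  field_simp
  ring

theorem liftPair_mem (lam mu : ℂ) (k : ℕ) {F : SF × SF} (hF : F ∈ symbolPairs (2 * k)) :
    liftPair lam mu k F (2 * k) ∈ symbolPairs 0 := by
  intro _
  rcases k with _ | k
  · exact hF rfl
  · rw [liftPair_even, matC_act, matD_act]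
    simp [coefA]

/-- The lift of a symbol `S` of degree `k`. -/
def lift (lam mu : ℂ) (k : ℕ) (S : symbolPairs (2 * k)) : Symbols :=
  DirectSum.mk (fun n => symbolPairs n) (Finset.range (2 * k + 1)) fun m =>
    ⟨liftPair lam mu k S (2 * k - m), fun h => by
      rw [h, Nat.sub_zero]
      exact liftPair_mem lam mu k S.2 rfl⟩

theorem lift_apply (lam mu : ℂ) (k : ℕ) (S : symbolPairs (2 * k)) {m : ℕ} (hm : m ≤ 2 * k) :
    (lift lam mu k S m : SF × SF) = liftPair lam mu k S (2 * k - m) := by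
  rw [lift, DirectSum.mk_apply_of_mem (Finset.mem_range.2 (by omega))]

theorem lift_apply_of_lt (lam mu : ℂ) (k : ℕ) (S : symbolPairs (2 * k)) {m : ℕ}
    (hm : 2 * k < m) : lift lam mu k S m = 0 :=
  DirectSum.mk_apply_of_notMem (by simpa using hm)

set_option maxHeartbeats 1000000 in
theorem isCasimirLift_lift {lam mu : ℂ} (hδ : ¬ IsCritical (mu - lam)) (k : ℕ)
    (S : symbolPairs (2 * k)) : IsCasimirLift lam mu (2 * k) S (lift lam mu k S) := by
  refine ⟨?_, fun m hm => lift_apply_of_lt lam mu k S hm, ?_⟩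
  · refine Subtype.ext ?_
    rw [lift_apply lam mu k S le_rfl, Nat.sub_self, liftPair_zero]
  rw [casimir_eq_smul_iff]
  intro m
  have hne (i : ℕ) (h0 : 0 < i) (hi : i ≤ 2 * k) :
      alpha (mu - lam) (2 * k) - alpha (mu - lam) (2 * k - i) ≠ 0 := by
    have h := alpha_sub_ne_zero hδ (show 2 * k - i < 2 * k by omega)
    rwa [Nat.cast_sub hi, Nat.cast_mul, Nat.cast_ofNat] at h
  rcases lt_trichotomy m (2 * k) with hm | rfl | hm
  · obtain ⟨i, hi⟩ : ∃ i, i + 1 = 2 * k - m := ⟨2 * k - m - 1, by omega⟩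
    have h₁ : alpha (mu - lam) (2 * k) - alpha (mu - lam) (2 * k - 1) ≠ 0 := by
      simpa using hne 1 (by omega) (by omega)
    rw [lift_apply lam mu k S hm.le, lift_apply lam mu k S (show m + 1 ≤ 2 * k by omega), ← hi,
      show 2 * k - (m + 1) = i by omega]
    rcases i with _ | i
    · rw [lift_apply_of_lt lam mu k S (show 2 * k < m + 2 by omega), show m + 1 = 2 * k by omega,
        show (m : ℤ) = 2 * k - 1 by omega, halfDrop_even, liftPair_zero]
      push_cast
      rw [map_zero, add_zero]
      exact liftPair_rec_one _ h₁
    · rw [lift_apply lam mu k S (show m + 2 ≤ 2 * k by omega), show 2 * k - (m + 2) = i by omega]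
      rcases Nat.even_or_odd' i with ⟨l, rfl | rfl⟩
      · obtain ⟨d, rfl⟩ : ∃ d, k = l + 1 + d := ⟨k - (l + 1), by omega⟩
        obtain rfl : m = 2 * d := by omega
        rw [halfDrop_odd, show 2 * d + 2 = 2 * (d + 1) by ring, unitDrop_even]
        have h₂ := hne (2 * (l + 1)) (by omega) (by omega)
        rcases l with _ | l
        · rw [show (d : ℂ) = (0 + 1 + d : ℕ) - 1 by push_cast; ring,
            show d + 1 = 0 + 1 + d by ring,
            show ((2 * d : ℕ) : ℤ) = 2 * (0 + 1 + d : ℕ) - 2 * (1 : ℕ) by push_cast; ring,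
            Nat.cast_mul 2 (0 + 1 + d), Nat.cast_ofNat]
          exact liftPair_rec_two S h₁ (by simpa using h₂)
        · have h₃ := hne (2 * (l + 1)) (by omega) (by omega)
          rw [show (d : ℂ) = (l + 1 + 1 + d : ℕ) - (l + 2 : ℕ) by push_cast; ring,
            show ((d + 1 : ℕ) : ℂ) = (l + 1 + 1 + d : ℕ) - (l + 1 : ℕ) by push_cast; ring,
            show ((2 * d : ℕ) : ℤ) = 2 * (l + 1 + 1 + d : ℕ) - 2 * (l + 2 : ℕ) by push_cast; ring,
            Nat.cast_mul 2 (l + 1 + 1 + d), Nat.cast_ofNat]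
          exact liftPair_rec_even S h₁ (by simpa using h₃)
            (by simpa [add_assoc, one_add_one_eq_two] using h₂)
      · obtain ⟨d, rfl⟩ : ∃ d, k = l + 1 + 1 + d := ⟨k - (l + 1 + 1), by omega⟩
        obtain rfl : m = 2 * d + 1 := by omega
        have h₂ := hne (2 * (l + 1)) (by omega) (by omega)
        rw [show 2 * d + 1 + 1 = 2 * (d + 1) by ring, halfDrop_even,
          show 2 * d + 1 + 2 = 2 * (d + 1) + 1 by ring, unitDrop_odd,
          show ((d + 1 : ℕ) : ℂ) = (l + 1 + 1 + d : ℕ) - (l + 1 : ℕ) by push_cast; ring,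
          show ((2 * d + 1 : ℕ) : ℤ) = 2 * (l + 1 + 1 + d : ℕ) - (2 * (l + 1 : ℕ) + 1) by
            push_cast; ring,
          Nat.cast_mul 2 (l + 1 + 1 + d), Nat.cast_ofNat]
        exact liftPair_rec_odd S h₁ (by simpa using h₂)
  · rw [lift_apply_of_lt lam mu k S (show 2 * k < 2 * k + 1 by omega),
      lift_apply_of_lt lam mu k S (show 2 * k < 2 * k + 2 by omega), sub_self, zero_smul]
    simp
  · rw [lift_apply_of_lt lam mu k S hm, lift_apply_of_lt lam mu k S (show 2 * k < m + 1 by omega),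
      lift_apply_of_lt lam mu k S (show 2 * k < m + 2 by omega)]
    simp

theorem gradInv_of_hasParity {p : Fin 2} {f : SF} (hf : SF.HasParity p f) :
    gradInv f = (-1 : ℂ) ^ (p : ℕ) • f := by
  fin_cases p <;> simp [SF.HasParity] at hf <;> ext1 <;> simp [hf]

theorem matAct_smul (M : Matrix (Fin 2) (Fin 2) Op) (z : ℂ) (F : SF × SF) :
    matAct M (z • F) = z • matAct M F := by
  simp [matAct]

/-- On pairs of parity `p` the grading involution is the sign `(-1)^p`. -/
theorem hasExplicitComponents_lift (lam mu : ℂ) (k : ℕ) (S : symbolPairs (2 * k)) :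
    HasExplicitComponents lam mu k S (lift lam mu k S) := by
  refine ⟨fun l h1 hl => ?_, fun p h1 h2 j hj => ?_⟩
  · obtain ⟨l, rfl⟩ : ∃ i, l = i + 1 := ⟨l - 1, by omega⟩
    rw [lift_apply _ _ _ _ (by omega), show 2 * k - (2 * k - 2 * (l + 1)) = 2 * (l + 1) by omega,
      liftPair_even]
  · have e : gradPair S = (-1 : ℂ) ^ (p : ℕ) • (S : SF × SF) :=
      Prod.ext (gradInv_of_hasParity h1) (gradInv_of_hasParity h2)
    rw [lift_apply _ _ _ _ (by omega), show 2 * k - (2 * k - (2 * j + 1)) = 2 * j + 1 by omega,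
      liftPair_odd, e, matAct_smul, smul_smul, mul_comm]

/-! ### Orders and principal symbols -/

/-- Symbols without components of degree `n / 2` or higher. -/
def below (n : ℕ) : Submodule ℂ Symbols where
  carrier := {T | ∀ m, n ≤ m → T m = 0}
  add_mem' := fun {T U} hT hU m hm => by
    rw [DirectSum.add_apply, hT m hm, hU m hm, add_zero]
  zero_mem' := fun _ _ => rfl
  smul_mem' := fun z T hT m hm => by
    rw [DirectSum.smul_apply, hT m hm, smul_zero]

theorem lof_mem_below {i n : ℕ} (h : i < n) (s : symbolPairs i) :
    DirectSum.lof ℂ ℕ (fun n => symbolPairs n) i s ∈ below n := fun m hm =>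
  DirectSum.of_eq_of_ne _ _ _ (show m ≠ i by omega)

theorem diffOps_eq (n : ℕ) : diffOps n = lowerDiffOps (n + 1) := by
  simp only [diffOps, lowerDiffOps, Nat.lt_succ_iff]

theorem monomial_mem {n l m p : ℕ} (a : SF) (h : 2 * l + m + p < n) :
    mulLeft a * dx ^ l * Dbar₁ ^ m * Dbar₂ ^ p ∈ lowerDiffOps n :=
  Submodule.subset_span ⟨a, l, m, p, h, rfl⟩

/-- An operator in normal form has order less than `n / 2` if its coefficients of order at least
`n / 2` vanish. -/
theorem normalOp_mul_dx_pow_mem {n k : ℕ} {q : Coeffs} (ha : 2 * k < n ∨ q.1 = 0)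
    (hb : 2 * k + 1 < n ∨ q.2.1 = 0) (hc : 2 * k + 1 < n ∨ q.2.2.1 = 0)
    (hd : 2 * k + 2 < n ∨ q.2.2.2 = 0) : normalOp q * dx ^ k ∈ lowerDiffOps n := by
  have e1 : Dbar₁ * dx ^ k = dx ^ k * Dbar₁ := (commute_dx_Dbar₁.pow_left k).eq.symm
  have e2 : Dbar₂ * dx ^ k = dx ^ k * Dbar₂ := (commute_dx_Dbar₂.pow_left k).eq.symm
  have e : normalOp q * dx ^ k = mulLeft q.1 * dx ^ k * Dbar₁ ^ 0 * Dbar₂ ^ 0 +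
      mulLeft q.2.1 * dx ^ k * Dbar₁ ^ 1 * Dbar₂ ^ 0 +
      mulLeft q.2.2.1 * dx ^ k * Dbar₁ ^ 0 * Dbar₂ ^ 1 +
      mulLeft q.2.2.2 * dx ^ k * Dbar₁ ^ 1 * Dbar₂ ^ 1 := by
    simp only [normalOp, add_mul, mul_assoc, e1, e2, pow_zero, pow_one, mul_one]
    rw [← mul_assoc Dbar₁ (dx ^ k), e1, mul_assoc]
  have mem {a : SF} {m p : ℕ} (h : 2 * k + m + p < n ∨ a = 0) :
      mulLeft a * dx ^ k * Dbar₁ ^ m * Dbar₂ ^ p ∈ lowerDiffOps n := by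
    rcases h with h | rfl
    · exact monomial_mem a h
    · simp
  rw [e]
  exact add_mem (add_mem (add_mem (mem ha) (mem hb)) (mem hc)) (mem hd)

theorem qAffPair_mem {i n : ℕ} (h : i < n) (s : symbolPairs i) :
    qAffPair i s ∈ lowerDiffOps n := by
  rcases Nat.even_or_odd' i with ⟨j, rfl | rfl⟩
  · rcases j with _ | j
    · have e := qAffPair_zero (s.2 rfl)
      rw [← mul_one (normalOp _), ← pow_zero dx] at e
      exact e ▸ normalOp_mul_dx_pow_mem (.inl h) (.inr rfl) (.inr rfl) (.inr rfl)
    · rw [qAffPair_even]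
      exact add_mem (normalOp_mul_dx_pow_mem (.inl h) (.inr rfl) (.inr rfl) (.inr rfl))
        (normalOp_mul_dx_pow_mem (.inr rfl) (.inr rfl) (.inr rfl) (.inl h))
  · rw [qAffPair_odd]
    exact normalOp_mul_dx_pow_mem (.inr rfl) (.inl h) (.inl h) (.inr rfl)

/-- Every monomial reduces to the image of `qAff` by `D̄ᵢ² = -∂_x`, which preserves the order. -/
theorem monomial_mem_map {n : ℕ} (a : SF) (N : ℕ) : ∀ l m p : ℕ, m + p = N →
    2 * l + m + p < n →
    mulLeft a * dx ^ l * Dbar₁ ^ m * Dbar₂ ^ p ∈ (below n).map qAff := by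
  have mem {i : ℕ} (h : i < n) (F : SF × SF) (hF : F ∈ symbolPairs i) :
      qAffPair i F ∈ (below n).map qAff :=
    ⟨_, lof_mem_below h ⟨F, hF⟩, qAff_lof i _⟩
  induction N using Nat.strong_induction_on with
  | _ N ih =>
    intro l m p hN h
    match m, p with
    | m + 2, p =>
      have e : mulLeft a * dx ^ l * Dbar₁ ^ (m + 2) * Dbar₂ ^ p =
          -(mulLeft a * dx ^ (l + 1) * Dbar₁ ^ m * Dbar₂ ^ p) := by
        rw [pow_add, pow_two, Dbar₁_sq, pow_succ, ← mul_assoc _ (Dbar₁ ^ m),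
          mul_assoc _ (Dbar₁ ^ m) (-dx), mul_neg, ← (commute_dx_Dbar₁.pow_right m).eq]
        simp only [mul_assoc, mul_neg, neg_mul]
      rw [e]
      exact neg_mem (ih (m + p) (by omega) (l + 1) m p rfl (by omega))
    | m, p + 2 =>
      have e : mulLeft a * dx ^ l * Dbar₁ ^ m * Dbar₂ ^ (p + 2) =
          -(mulLeft a * dx ^ (l + 1) * Dbar₁ ^ m * Dbar₂ ^ p) := by
        rw [pow_add, pow_two, Dbar₂_sq, mul_neg, ← (commute_dx_Dbar₂.pow_right p).eq, pow_succ,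
          mul_neg, mul_assoc (mulLeft a * _), ← mul_assoc (Dbar₁ ^ m),
          ← (commute_dx_Dbar₁.pow_right m).eq]
        simp only [mul_assoc]
      rw [e]
      exact neg_mem (ih (m + p) (by omega) (l + 1) m p rfl (by omega))
    | 0, 0 =>
      have e := mem (i := 2 * l) (by omega) (a, 0) fun _ => rfl
      simpa [qAffPair] using e
    | 1, 0 =>
      have e := mem (i := 2 * l + 1) (by omega) (a, 0) fun h0 => absurd h0 (by omega)
      rw [qAffPair_odd] at e
      simpa [normalOp, mul_assoc, (commute_dx_Dbar₁.pow_left l).eq] using e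
    | 0, 1 =>
      have e := mem (i := 2 * l + 1) (by omega) (0, a) fun h0 => absurd h0 (by omega)
      rw [qAffPair_odd] at e
      simpa [normalOp, mul_assoc, (commute_dx_Dbar₂.pow_left l).eq] using e
    | 1, 1 =>
      have e := mem (i := 2 * (l + 1)) (by omega) (0, a) fun h0 => absurd h0 (by omega)
      have hl : 2 * (l + 1) / 2 - 1 = l := by omega
      simpa [qAffPair, hl, mul_assoc] using e

/-- The affine quantization identifies the order filtration with the degree filtration. -/
theorem lowerDiffOps_eq (n : ℕ) : lowerDiffOps n = (below n).map qAff := by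
  classical
  apply le_antisymm
  · refine Submodule.span_le.2 ?_
    rintro _ ⟨a, l, m, p, h, rfl⟩
    exact monomial_mem_map a _ l m p rfl h
  · rintro _ ⟨T, hT, rfl⟩
    rw [qAff_eq_sum]
    refine Submodule.sum_mem _ fun i hi => qAffPair_mem ?_ (T i)
    by_contra h
    exact DFinsupp.mem_support_iff.1 hi (hT i (by omega))

theorem opLie_normalOp_mem {lam mu : ℂ} {f : SF} (hf : f ∈ spo) {n k : ℕ} {q : Coeffs}
    (ha : 2 * k < n ∨ (lieTop lam mu k f q).1 = 0)
    (hb : 2 * k + 1 < n ∨ (lieTop lam mu k f q).2.1 = 0)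
    (hc : 2 * k + 1 < n ∨ (lieTop lam mu k f q).2.2.1 = 0)
    (hd : 2 * k + 2 < n ∨ (lieTop lam mu k f q).2.2.2 = 0) (hk : 2 * k < n) :
    opLie lam mu f (normalOp q * dx ^ k) ∈ lowerDiffOps n := by
  obtain ⟨z, hz⟩ := dx_dx_eq_smul_one hf
  rw [opLie_normalOp_mul_dx_pow lam mu hz]
  refine add_mem (normalOp_mul_dx_pow_mem ha hb hc hd) ?_
  rcases k with _ | k
  · simp
  · exact Submodule.smul_mem _ _ (normalOp_mul_dx_pow_mem (.inl (by omega)) (.inl (by omega))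
      (.inl (by omega)) (.inl (by omega)))

theorem vec_zero (f : SF) : vec f 0 = 0 := by
  have h0 (g : SF) : g * 0 = 0 := (mulLeft g).map_zero
  simp [vec, h0]

/-- The Lie derivatives along `spo(2|2)` do not raise the order: contact fields preserve the
filtration in which `∂_x` has order one and `D̄₁, D̄₂` have order one half. -/
theorem opLie_mem {lam mu : ℂ} {f : SF} (hf : f ∈ spo) {n : ℕ} {D : Op}
    (hD : D ∈ lowerDiffOps n) : opLie lam mu f D ∈ lowerDiffOps n := by
  classical
  have h0 (g : SF) : g * 0 = 0 := (mulLeft g).map_zero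
  have key {i : ℕ} (hi : i < n) (s : symbolPairs i) :
      opLie lam mu f (qAffPair i s) ∈ lowerDiffOps n := by
    rcases Nat.even_or_odd' i with ⟨j, rfl | rfl⟩
    · have h1 : opLie lam mu f (normalOp (s.1.1, 0, 0, 0) * dx ^ j) ∈ lowerDiffOps n := by
        refine opLie_normalOp_mem hf (.inl hi) (.inr ?_) (.inr ?_) (.inr ?_) hi <;>
          simp [lieTop, lieCoeffs, signedCoeffsDx, vec_zero, h0]
      rcases j with _ | j
      · have e := qAffPair_zero (s.2 rfl)
        rw [pow_zero, mul_one, ← e] at h1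
        exact h1
      · rw [qAffPair_even, opLie_add]
        refine add_mem h1 ?_
        exact opLie_normalOp_mem hf (.inl (by omega)) (.inl (by omega)) (.inl (by omega))
          (.inl (by omega)) (by omega)
    · rw [qAffPair_odd]
      refine opLie_normalOp_mem hf (.inl (by omega)) (.inl (by omega)) (.inl (by omega))
        (.inr ?_) (by omega)
      simp [lieTop, lieCoeffs, signedCoeffsDx, vec_zero, h0]
  rw [lowerDiffOps_eq] at hD
  obtain ⟨T, hT, rfl⟩ := hD
  let L : Op →ₗ[ℂ] Op := ⟨⟨opLie lam mu f, opLie_add lam mu f⟩, opLie_smul lam mu f⟩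
  change L _ ∈ _
  rw [qAff_eq_sum, map_sum]
  refine Submodule.sum_mem _ fun i hi => key ?_ (T i)
  by_contra h
  exact DFinsupp.mem_support_iff.1 hi (hT i (by omega))

theorem exists_isSymbol {n : ℕ} {D : Op} (hD : D ∈ diffOps n) : ∃ t, IsSymbol n D t := by
  have h := hD
  rw [diffOps_eq, lowerDiffOps_eq] at h
  obtain ⟨T, hT, rfl⟩ := h
  refine ⟨T n, hD, ?_⟩
  rw [← qAff_lof, ← map_sub, lowerDiffOps_eq]
  refine ⟨_, fun m hm => ?_, rfl⟩
  rw [DirectSum.sub_apply]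
  rcases hm.eq_or_lt with rfl | hm
  · rw [DirectSum.lof_apply, sub_self]
  · rw [hT m hm, lof_mem_below hm (T n) m le_rfl, sub_zero]

theorem IsSymbol.unique {n : ℕ} {D : Op} {s t : symbolPairs n} (hs : IsSymbol n D s)
    (ht : IsSymbol n D t) : s = t := by
  have h := sub_mem hs.2 ht.2
  rw [sub_sub_sub_cancel_left, ← qAff_lof, ← qAff_lof, ← map_sub, lowerDiffOps_eq] at h
  obtain ⟨T, hT, hTs⟩ := h
  have e := hT n le_rfl
  rw [qAff_injective hTs, DirectSum.sub_apply, DirectSum.lof_apply, DirectSum.lof_apply] at e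
  exact (sub_eq_zero.1 e).symm

/-- The action on symbols is well defined: the Lie derivative of any operator with principal symbol
`s` has the principal symbol of the Lie derivative of the affine representative of `s`. -/
theorem IsSymbol.opLie {lam mu : ℂ} {f : SF} (hf : f ∈ spo) {n : ℕ} {D : Op}
    {s t : symbolPairs n} (hs : IsSymbol n D s)
    (ht : IsSymbol n (opLie lam mu f (qAffPair n s)) t) :
    IsSymbol n (SuperQuant.opLie lam mu f D) t := by
  have h1 := hs.1
  rw [diffOps_eq] at h1
  refine ⟨by rw [diffOps_eq]; exact opLie_mem hf h1, ?_⟩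
  have h := add_mem (opLie_mem (lam := lam) (mu := mu) hf hs.2) ht.2
  have e : SuperQuant.opLie lam mu f D = SuperQuant.opLie lam mu f (D - qAffPair n s) +
      SuperQuant.opLie lam mu f (qAffPair n s) := by
    rw [← opLie_add, sub_add_cancel]
  rwa [← add_sub_assoc, ← e] at h

/-! ### Equivariant quantizations -/

theorem spoDual_mem (i : Fin 8) : spoDual i ∈ spo := by
  have h (j : Fin 8) (z : ℂ) : z • spoGen j ∈ spo := Submodule.smul_mem _ _ (spoGen_mem j)
  obtain ⟨h0, h1, h2, h3, h4, h5, h6, h7⟩ := spoDual_rules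
  fin_cases i
  · exact h0 ▸ neg_mem (h 7 _)
  · exact h1 ▸ neg_mem (spoGen_mem 5)
  · exact h2 ▸ neg_mem (spoGen_mem 6)
  · exact h3 ▸ spoGen_mem 3
  · exact h4 ▸ spoGen_mem 4
  · exact h5 ▸ spoGen_mem 1
  · exact h6 ▸ spoGen_mem 2
  · exact h7 ▸ neg_mem (h 0 _)

/-- The Casimir operator multiplies principal symbols of degree `n / 2` by `α`. -/
theorem isSymbol_casimir (lam mu : ℂ) (n : ℕ) (s : symbolPairs n) :
    IsSymbol n (casimir lam mu (qAffPair n s)) (alpha (mu - lam) n • s) := by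
  have hmem : casimir lam mu (qAffPair n s) ∈ diffOps n := by
    rw [diffOps_eq]
    exact Submodule.sum_mem _ fun i _ => opLie_mem (spoDual_mem i)
      (opLie_mem (spoGen_mem i) (qAffPair_mem n.lt_succ_self s))
  refine ⟨hmem, ?_⟩
  have hhalf : halfPart lam n s ∈ below n := by
    match n, s with
    | 0, s => exact zero_mem _
    | n + 1, s => exact lof_mem_below n.lt_succ_self _
  have hunit : unitPart lam n s ∈ below n := by
    match n, s with
    | 0, s => exact zero_mem _
    | 1, s => exact zero_mem _
    | n + 2, s => exact lof_mem_below (by omega) _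
  rw [casimir_qAffPair, symbolCasimir_lof, add_assoc, map_add, map_smul, qAff_lof,
    Submodule.coe_smul, map_smul, add_sub_cancel_left, lowerDiffOps_eq]
  exact ⟨_, add_mem hhalf hunit, rfl⟩

/-- An equivariant quantization commutes with the Casimir operators, and the one on symbols of
degree `n / 2` is the scalar `α`. -/
theorem IsEquivariantQuantization.casimir_eq {lam mu : ℂ} {Q : Symbols →ₗ[ℂ] Op}
    (hQ : IsEquivariantQuantization lam mu Q) (n : ℕ) (s : symbolPairs n) :
    casimir lam mu (Q (DirectSum.lof ℂ ℕ (fun n => symbolPairs n) n s)) =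
      alpha (mu - lam) n • Q (DirectSum.lof ℂ ℕ (fun n => symbolPairs n) n s) := by
  have hex (f : SF) (hf : f ∈ spo) (s : symbolPairs n) :
      ∃ t, IsSymbol n (opLie lam mu f (qAffPair n s)) t := by
    refine exists_isSymbol ?_
    rw [diffOps_eq]
    exact opLie_mem hf (qAffPair_mem n.lt_succ_self s)
  -- Follow the principal symbols through both factors of each product in the Casimir operator.
  choose t ht using fun i => hex (spoGen i) (spoGen_mem i) s
  choose u hu using fun i => hex (spoDual i) (spoDual_mem i) (t i)
  have hsum : IsSymbol n (casimir lam mu (qAffPair n s)) (∑ i, u i) := by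
    refine ⟨(isSymbol_casimir lam mu n s).1, ?_⟩
    rw [casimir, AddSubmonoidClass.coe_finsetSum, map_sum, ← Finset.sum_sub_distrib]
    exact Submodule.sum_mem _ fun i _ => ((ht i).opLie (spoDual_mem i) (hu i)).2
  rw [casimir, ← map_smul, ← map_smul, ← hsum.unique (isSymbol_casimir lam mu n s), map_sum,
    map_sum]
  refine Finset.sum_congr rfl fun i _ => ?_
  rw [hQ.equivariant _ (spoGen_mem i) n s (t i) (ht i),
    hQ.equivariant _ (spoDual_mem i) n (t i) (u i) (hu i)]

/-- The value of an equivariant quantization is the affine quantization of a lift, since it has the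
right principal symbol and the right eigenvalue. -/
theorem IsEquivariantQuantization.exists_isCasimirLift {lam mu : ℂ} {Q : Symbols →ₗ[ℂ] Op}
    (hQ : IsEquivariantQuantization lam mu Q) (n : ℕ) (s : symbolPairs n) :
    ∃ T, IsCasimirLift lam mu n s T ∧
      Q (DirectSum.lof ℂ ℕ (fun n => symbolPairs n) n s) = qAff T := by
  have h := (hQ.symbol n s).2
  rw [lowerDiffOps_eq] at h
  obtain ⟨T, hT, hTQ⟩ := h
  have e : Q (DirectSum.lof ℂ ℕ (fun n => symbolPairs n) n s) =
      qAff (DirectSum.lof ℂ ℕ (fun n => symbolPairs n) n s + T) := by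
    rw [map_add, qAff_lof, hTQ, add_sub_cancel]
  refine ⟨_, ⟨?_, fun m hm => ?_, ?_⟩, e⟩
  · rw [DirectSum.add_apply, DirectSum.lof_apply, hT n le_rfl, add_zero]
  · rw [DirectSum.add_apply, lof_mem_below hm s m le_rfl, hT m hm.le, add_zero]
  · rw [← e]
    exact hQ.casimir_eq n s

end

end SuperQuant

theorem proposition5p1 (lam mu : ℂ) (hδ : ¬ SuperQuant.IsCritical (mu - lam)) (k : ℕ) :
    (∀ S : SuperQuant.symbolPairs (2 * k),
      (∃! T : SuperQuant.Symbols, SuperQuant.IsCasimirLift lam mu (2 * k) S T) ∧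
      (∀ T : SuperQuant.Symbols, SuperQuant.IsCasimirLift lam mu (2 * k) S T →
        SuperQuant.HasExplicitComponents lam mu k S T) ∧
      (∀ Q : SuperQuant.Symbols →ₗ[ℂ] SuperQuant.Op,
        SuperQuant.IsEquivariantQuantization lam mu Q →
        ∃ T : SuperQuant.Symbols, SuperQuant.IsCasimirLift lam mu (2 * k) S T ∧
          Q (DirectSum.lof ℂ ℕ (fun n => SuperQuant.symbolPairs n) (2 * k) S) =
            SuperQuant.qAff T)) ∧
    SuperQuant.coefC lam mu k 1 =
      1 / (SuperQuant.alpha (mu - lam) (2 * k) - SuperQuant.alpha (mu - lam) (2 * k - 2)) ∧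
    SuperQuant.coefD lam mu k 1 =
      -(1 / (2 * (SuperQuant.alpha (mu - lam) (2 * k) - SuperQuant.alpha (mu - lam) (2 * k - 1)) *
        (SuperQuant.alpha (mu - lam) (2 * k) - SuperQuant.alpha (mu - lam) (2 * k - 2)))) ∧
    SuperQuant.coefE lam mu k 0 =
      1 / (2 * (SuperQuant.alpha (mu - lam) (2 * k) - SuperQuant.alpha (mu - lam) (2 * k - 1))) := by
  refine ⟨fun S => ?_, ?_, ?_, ?_⟩
  · have hlift := SuperQuant.isCasimirLift_lift hδ k S
    refine ⟨⟨_, hlift, fun T hT => hT.unique hδ hlift⟩, fun T hT => ?_,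
      fun Q hQ => hQ.exists_isCasimirLift (2 * k) S⟩
    rw [hT.unique hδ hlift]
    exact SuperQuant.hasExplicitComponents_lift lam mu k S
  · simp [SuperQuant.coefC]
  · simp [SuperQuant.coefD, neg_div]
  · simp [SuperQuant.coefE]
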